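/- **Setting.** Let $f,h:[0,1]\to\mathbb R$ be twice continuously differentiable with $f(1)<0<f(0)$, $h(1)=0$, $h'(1)\neq 0$ and $h>0$ on $[0,1)$, and let $\beta\in(0,1/2)$. For $\varepsilon>0$ let $x^\varepsilon:[0,\infty)\to[0,1]$ be the solution of $\varepsilon\dot x^\varepsilon_t=\varepsilon f(x^\varepsilon_t)+x^\varepsilon_t h(x^\varepsilon_t)$, $x^\varepsilon_0=0$. Let $(\sigma^\varepsilon_n)_{n\ge1}$ be i.i.d. positive random variables with $\mathbb P(\sigma_n^\varepsilon>t)=\exp\left(-\varepsilon^{-1}\int_0^t h(x^\varepsilon_s)\,ds\right)$ for $t>0$, and put $\tau^\varepsilon_0=0$, $\tau^\varepsilon_n=\sigma^\varepsilon_1+\dots+\sigma^\varepsilon_n$. The resetting process is $X^\varepsilon_t=x^\varepsilon_{t-\tau^\varepsilon_n}$ for $t\in[\tau^\varepsilon_n,\tau^\varepsilon_{n+1})$, $n\ge0$. The pre-spikes are the points $(\tau^\varepsilon_i,z^\varepsilon_i)$, $i\ge1$, where $z^\varepsilon_i=X^\varepsilon_{\tau^\varepsilon_i-}$ is the left limit.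 For $A\subset(0,1]$ let $N^\varepsilon_{(0,r]}(A)$ be the number of pre-spikes in $(0,r]\times A$. Let $e^\varepsilon_1=\inf\{t\ge0: X^\varepsilon_t>1-\varepsilon^\beta\}$ (with $\inf\emptyset=+\infty$); the event that there is no jump on $(0,t)$ is $\{e_1^\varepsilon\ge t\}$. Finally let $\lambda_*(dx)=f(0)\,x^{-2}\mathbf 1_{[0,1]}(x)\,dx$. **Corollary 2.4.** Let $0<a\le b\le1$. Then $\lambda_*([a,b])=f(0)\left(\frac1a-\frac1b\right)$, and the following hold as $\varepsilon\to0^+$. 1. For every $t>0$ we have $\mathbb P(e_1^\varepsilon\ge t)>0$ for all sufficiently small $\varepsilon>0$, and the conditional law of the number of pre-spikes in $(0,t)\times[a,b]$ given $\{e_1^\varepsilon\ge t\}$, that is, the probability distribution on $\mathbb N_0$ with mass $$n\mapsto\frac{\mathbb P\big(\text{exactly } n \text{ pre-spikes lie in } (0,t)\times[a,b],\ e_1^\varepsilon\ge t\big)}{\mathbb P(e_1^\varepsilon\ge t)},$$ converges in law to the Poisson distribution with parameter $f(0)\,t\left(\frac1a-\frac1b\right)$. 2. For every integer $n\ge0$,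 the function $r\mapsto\mathbb P\big(e_1^\varepsilon\ge r,\ N^\varepsilon_{(0,r]}([a,b])=n\big)$ converges, uniformly on every compact interval $[0,T]$ with $T>0$, to $$r\mapsto e^{-rf(0)}\,e^{-r\lambda_*([a,b])}\,\frac{\big(r\lambda_*([a,b])\big)^n}{n!}$$ (with $0^0=1$). -/

import Mathlib

open Set Filter Topology MeasureTheory ProbabilityTheory

namespace Resetting

/-- Standing assumptions on the coefficients `f, h : [0,1] → ℝ` (values outside `[0,1]` are
irrelevant). -/
structure Coefficients (f h : ℝ → ℝ) : Prop where
  contDiff_f : ContDiffOn ℝ 2 f (Icc 0 1)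
  contDiff_h : ContDiffOn ℝ 2 h (Icc 0 1)
  f_one_neg : f 1 < 0
  f_zero_pos : 0 < f 0
  h_one : h 1 = 0
  deriv_h_one : derivWithin h (Icc 0 1) 1 ≠ 0
  h_pos : ∀ x ∈ Ico (0 : ℝ) 1, 0 < h x

/-- `x` is the deterministic flow started from `0`: it takes its values in `[0,1]` and solves
`ε x' = ε f(x) + x h(x)`, `x 0 = 0`, on `[0,∞)`. -/
structure IsFlow (f h : ℝ → ℝ) (ε : ℝ) (x : ℝ → ℝ) : Prop where
  init : x 0 = 0
  mem_Icc : ∀ t, 0 ≤ t → x t ∈ Icc (0 : ℝ) 1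
  ode : ∀ t, 0 ≤ t →
    HasDerivWithinAt x (ε⁻¹ * (ε * f (x t) + x t * h (x t))) (Ici 0) t

/-- `σ 0, σ 1, …` (the waiting times `σ₁, σ₂, …`) are i.i.d. positive random variables with
`ℙ(σ > t) = exp (-ε⁻¹ ∫₀ᵗ h(x_s) ds)` for all `t > 0`. -/
structure IsWaitingTimes {Ω : Type*} [MeasurableSpace Ω] (P : Measure Ω)
    (h : ℝ → ℝ) (ε : ℝ) (x : ℝ → ℝ) (σ : ℕ → Ω → ℝ) : Prop where
  measurable : ∀ n, Measurable (σ n)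
  indep : iIndepFun σ P
  pos : ∀ n, ∀ᵐ ω ∂P, 0 < σ n ω
  tail : ∀ n, ∀ t : ℝ, 0 < t →
    P.real {ω | t < σ n ω} = Real.exp (-(ε⁻¹ * ∫ s in (0 : ℝ)..t, h (x s)))

/-! In the next definitions `s : ℕ → ℝ` is one realisation of the waiting times. -/

/-- Reset times: `τ_0 = 0` and `τ_n = σ_1 + ⋯ + σ_n`. -/
def resetTime (s : ℕ → ℝ) (n : ℕ) : ℝ := ∑ i ∈ Finset.range n, s i

/-- The number of resets in `(0, t]`, i.e. the index `n` with `τ_n ≤ t < τ_{n+1}`. -/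
noncomputable def resetIndex (s : ℕ → ℝ) (t : ℝ) : ℕ := sSup {n : ℕ | resetTime s n ≤ t}

/-- The resetting process: `X_t = x_{t - τ_n}` for `t ∈ [τ_n, τ_{n+1})`. -/
noncomputable def process (x : ℝ → ℝ) (s : ℕ → ℝ) (t : ℝ) : ℝ :=
  x (t - resetTime s (resetIndex s t))

/-- The set of pre-spikes `(τ_i, X_{τ_i -})`, `i ≥ 1`. -/
noncomputable def preSpikes (x : ℝ → ℝ) (s : ℕ → ℝ) : Set (ℝ × ℝ) :=
  {p | ∃ i : ℕ, 1 ≤ i ∧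
    p = (resetTime s i, Function.leftLim (process x s) (resetTime s i))}

/-- The number of pre-spikes in `I × A`. -/
noncomputable def preSpikeCount (x : ℝ → ℝ) (s : ℕ → ℝ) (I A : Set ℝ) : ℕ∞ :=
  (preSpikes x s ∩ I ×ˢ A).encard

/-- The first time at which the process exceeds `y`, with `inf ∅ = +∞`. -/
noncomputable def firstJump (x : ℝ → ℝ) (y : ℝ) (s : ℕ → ℝ) : EReal :=
  sInf ((fun t : ℝ => (t : EReal)) '' {t : ℝ | 0 ≤ t ∧ y < process x s t})

/-- The event `e_1 ≥ t` that there is no jump on `(0, t)`; the threshold is `1 - ε ^ β`. -/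
def noJump {Ω : Type*} (β ε : ℝ) (x : ℝ → ℝ) (σ : ℕ → Ω → ℝ) (t : ℝ) : Set Ω :=
  {ω | (t : EReal) ≤ firstJump x (1 - ε ^ β) (fun n => σ n ω)}

/-- The event that there are exactly `n` pre-spikes in `I × A`. -/
def countEq {Ω : Type*} (x : ℝ → ℝ) (σ : ℕ → Ω → ℝ) (I A : Set ℝ) (n : ℕ) : Set Ω :=
  {ω | preSpikeCount x (fun k => σ k ω) I A = (n : ℕ∞)}

/-- The probability of exactly `n` pre-spikes in `(0,t) × [a,b]` given that there is no jump
on `(0,t)`. -/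
noncomputable def condProb {Ω : Type*} [MeasurableSpace Ω] (P : Measure Ω) (β ε : ℝ)
    (x : ℝ → ℝ) (σ : ℕ → Ω → ℝ) (t a b : ℝ) (n : ℕ) : ℝ :=
  P.real (countEq x σ (Ioo 0 t) (Icc a b) n ∩ noJump β ε x σ t) / P.real (noJump β ε x σ t)

/-- The distribution on `ℕ` whose mass at `n` is the preceding conditional probability. -/
noncomputable def condLaw {Ω : Type*} [MeasurableSpace Ω] (P : Measure Ω) (β ε : ℝ)
    (x : ℝ → ℝ) (σ : ℕ → Ω → ℝ) (t a b : ℝ) : Measure ℕ :=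
  Measure.sum fun n => ENNReal.ofReal (condProb P β ε x σ t a b n) • Measure.dirac n

/-- `Φ_n^ε(r) = ℙ(e_1 ≥ r, N_{(0,r]}([a,b]) = n)`. -/
noncomputable def jointProb {Ω : Type*} [MeasurableSpace Ω] (P : Measure Ω) (β ε : ℝ)
    (x : ℝ → ℝ) (σ : ℕ → Ω → ℝ) (a b : ℝ) (n : ℕ) (r : ℝ) : ℝ :=
  P.real (noJump β ε x σ r ∩ countEq x σ (Ioc 0 r) (Icc a b) n)

/-- The spatial intensity `λ_*(dx) = f(0) x⁻² 1_{[0,1]}(x) dx`. -/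
noncomputable def lamStar (f : ℝ → ℝ) : Measure ℝ :=
  (volume.restrict (Icc 0 1)).withDensity fun x => ENNReal.ofReal (f 0 / x ^ 2)

end Resetting

namespace Resetting

/-! The resets cut the process into i.i.d. excursions. Let `T` be the time at which the flow reaches
`1 - ε ^ β`, `S` the tail of a waiting time and `m = ∫₀ᵀ S` the mean of `min σ T`; both `T` and `m`
tend to `0`. An excursion produces a jump when `σ > T` (probability `q`) and is marked when it ends
at a level in `[a,b]` (probability `p`).

The rates come from one identity. Since `S' = -ε⁻¹ h(x) S`, the large term of the drift cancels in
`(x S)'`, leaving `(x S)' = f(x) S`. Nearly all of the mass of `S` on `[0,T]` sits where `x` is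
close to `0`, so at the time `θ` of reaching `u` one gets `u S(θ) ≈ f(0) m`
(`abs_mul_survival_sub_le`, `tendsto_survival_div`). Hence `p / m → f(0) (1/a - 1/b)` and `q / m →
f(0)`.

By Chebyshev, about `r / m` excursions fit into `(0,r]`, because the variance of `min σ T` is at
most `m T`. Replacing this random number by a deterministic one costs little (`abs_prob_sub_le`) and
leaves an exact binomial weight (`prob_marks_eq`), whose limit is Poisson (`tendsto_binomial`).
Dividing by the no-jump probability gives the conditional law; letting `r` vary with `ε` gives
uniformity on compact intervals. -/

/-! ### Bounds on the coefficients and on the drift. -/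

theorem Coefficients.h_nonneg {f h : ℝ → ℝ} (hfh : Coefficients f h) {u : ℝ}
    (hu : u ∈ Icc (0 : ℝ) 1) : 0 ≤ h u := by
  rcases hu.2.lt_or_eq with h1 | rfl
  · exact (hfh.h_pos u ⟨hu.1, h1⟩).le
  · exact hfh.h_one.ge

/-- `h` dominates a positive multiple of the distance to `1`. -/
theorem Coefficients.exists_mul_le {f h : ℝ → ℝ} (hfh : Coefficients f h) :
    ∃ c > 0, ∀ u ∈ Icc (0 : ℝ) 1, c * (1 - u) ≤ h u := by
  have hd : HasDerivWithinAt h (derivWithin h (Icc 0 1) 1) (Icc 0 1) 1 :=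
    ((hfh.contDiff_h.differentiableOn (by norm_num)) 1 (by simp)).hasDerivWithinAt
  set d := derivWithin h (Icc 0 1) 1
  rw [hasDerivWithinAt_iff_tendsto_slope] at hd
  have hset : Icc (0 : ℝ) 1 \ {1} = Ico 0 1 := by
    ext u; simp only [Set.mem_sdiff, mem_Icc, mem_singleton_iff, mem_Ico]
    exact ⟨fun h => ⟨h.1.1, lt_of_le_of_ne h.1.2 h.2⟩, fun h => ⟨⟨h.1, h.2.le⟩, h.2.ne⟩⟩
  rw [hset] at hd
  have : (𝓝[Ico (0 : ℝ) 1] 1).NeBot := by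
    rw [← mem_closure_iff_nhdsWithin_neBot, closure_Ico (by norm_num)]; simp
  have hsl : ∀ u ∈ Ico (0 : ℝ) 1, slope h 1 u = -(h u / (1 - u)) := fun u hu => by
    have : 1 - u ≠ 0 := by linarith [hu.2]
    have : u - 1 ≠ 0 := by linarith [hu.2]
    rw [slope_def_field, hfh.h_one]; field_simp; ring
  -- The slopes at `1` are `-h(u) / (1 - u) ≤ 0`, so the nonzero derivative is negative; this gives
  -- the bound near `1`, and compactness gives it elsewhere.
  have hd0 : d ≤ 0 := by
    refine le_of_tendsto hd ?_
    filter_upwards [self_mem_nhdsWithin] with u hu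
    rw [hsl u hu, neg_nonpos]
    exact div_nonneg (hfh.h_pos u hu).le (by linarith [hu.2])
  have hdneg : d < 0 := lt_of_le_of_ne hd0 hfh.deriv_h_one
  have hev := hd.eventually_lt_const (show d < d / 2 by linarith)
  rw [eventually_nhdsWithin_iff, Metric.eventually_nhds_iff] at hev
  obtain ⟨δ, hδ, hev⟩ := hev
  obtain ⟨v, hv, hmin⟩ := (isCompact_Icc (a := (0 : ℝ)) (b := max 0 (1 - δ / 2))).exists_isMinOn
    ⟨0, by simp⟩ (f := h) (hfh.contDiff_h.continuousOn.mono
      (Icc_subset_Icc le_rfl (max_le (by norm_num) (by linarith))))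
  have hv1 : v < 1 := lt_of_le_of_lt hv.2 (max_lt (by norm_num) (by linarith))
  have hhv := hfh.h_pos v ⟨hv.1, hv1⟩
  refine ⟨min (h v) (-d / 2), lt_min hhv (by linarith), fun u hu => ?_⟩
  rcases le_or_gt u (max 0 (1 - δ / 2)) with hle | hgt
  · calc _ ≤ h v * 1 := mul_le_mul (min_le_left _ _) (by linarith [hu.1]) (by linarith [hu.2])
          hhv.le
      _ ≤ h u := by rw [mul_one]; exact hmin ⟨hu.1, hle⟩
  · rcases hu.2.lt_or_eq with h1 | rfl
    · have := hev (y := u) (by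
        rw [Real.dist_eq, abs_lt]
        constructor <;> linarith [le_max_right 0 (1 - δ / 2)]) ⟨hu.1, h1⟩
      rw [hsl u ⟨hu.1, h1⟩] at this
      have h2 : -d / 2 < h u / (1 - u) := by linarith
      rw [lt_div_iff₀ (by linarith)] at h2
      exact (mul_le_mul_of_nonneg_right (min_le_right _ _) (by linarith)).trans h2.le
    · simp [hfh.h_one]

theorem Coefficients.exists_bound {f h : ℝ → ℝ} (hfh : Coefficients f h) :
    ∃ F > 0, ∀ u ∈ Icc (0 : ℝ) 1, |f u| ≤ F := by
  obtain ⟨C, hC⟩ := isCompact_Icc.exists_bound_of_continuousOn hfh.contDiff_f.continuousOn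
  exact ⟨max C 1, by positivity, fun u hu => (hC u hu).trans (le_max_left _ _)⟩

theorem Coefficients.exists_close {f h : ℝ → ℝ} (hfh : Coefficients f h) {η : ℝ} (hη : 0 < η) :
    ∃ δ > 0, ∀ u ∈ Icc (0 : ℝ) 1, u ≤ δ → |f u - f 0| ≤ η := by
  have := hfh.contDiff_f.continuousOn 0 (by simp)
  rw [Metric.continuousWithinAt_iff] at this
  obtain ⟨δ, hδ, H⟩ := this η hη
  refine ⟨δ / 2, by positivity, fun u hu hle => ?_⟩
  have := H hu (by rw [Real.dist_eq, sub_zero, abs_of_nonneg hu.1]; linarith)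
  rw [Real.dist_eq] at this
  exact this.le

/-- The velocity of the flow at `u`. -/
noncomputable def drift (f h : ℝ → ℝ) (ε u : ℝ) : ℝ := ε⁻¹ * (ε * f u + u * h u)

theorem drift_eq {f h : ℝ → ℝ} {ε : ℝ} (hε : 0 < ε) (u : ℝ) :
    drift f h ε u = f u + ε⁻¹ * (u * h u) := by
  unfold drift; field_simp

theorem Coefficients.le_drift {f h : ℝ → ℝ} (hfh : Coefficients f h) {ε u : ℝ} (hε : 0 < ε)
    (hu : u ∈ Icc (0 : ℝ) 1) : f u ≤ drift f h ε u := by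
  rw [drift_eq hε]
  have := mul_nonneg (inv_pos.2 hε).le (mul_nonneg hu.1 (hfh.h_nonneg hu))
  linarith

/-- Away from `0` and up to `1 - ε ^ β` the velocity is eventually arbitrarily large. -/
theorem Coefficients.eventually_le_drift {f h : ℝ → ℝ} (hfh : Coefficients f h) {β : ℝ}
    (hβ : β ∈ Ioo (0 : ℝ) (1 / 2)) {η : ℝ} (hη : 0 < η) (K : ℝ) :
    ∀ᶠ ε in 𝓝[>] (0 : ℝ), ∀ u ∈ Icc η (1 - ε ^ β), K ≤ drift f h ε u := by
  obtain ⟨c, hc, hch⟩ := hfh.exists_mul_le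
  obtain ⟨F, hF, hfF⟩ := hfh.exists_bound
  have hlim : Tendsto (fun ε : ℝ => (K + F) * ε ^ (1 - β)) (𝓝[>] 0) (𝓝 0) := by
    have : ContinuousAt (fun ε : ℝ => (K + F) * ε ^ (1 - β)) 0 :=
      (Real.continuousAt_rpow_const 0 (1 - β) (Or.inr (by linarith [hβ.2]))).const_mul _
    have h2 := this.tendsto
    simp only [Real.zero_rpow (show 1 - β ≠ 0 by linarith [hβ.2]), mul_zero] at h2
    exact h2.mono_left nhdsWithin_le_nhds
  filter_upwards [self_mem_nhdsWithin, hlim.eventually_lt_const (show 0 < η * c by positivity)]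
    with ε (hε : 0 < ε) hlt u hu
  have hp : 0 < ε ^ β := Real.rpow_pos_of_pos hε _
  have hu01 : u ∈ Icc (0 : ℝ) 1 := ⟨hη.le.trans hu.1, by linarith [hu.2]⟩
  -- Here `h u ≥ c ε ^ β`, so `ε⁻¹ u h(u) ≥ η c ε ^ (β - 1)`, which blows up; the extra `F` absorbs
  -- `f`.
  have h1 : (K + F) * ε ≤ u * h u := by
    have e : ε ^ (1 - β) * ε ^ β = ε := by
      rw [← Real.rpow_add hε]; simp
    calc (K + F) * ε = ((K + F) * ε ^ (1 - β)) * ε ^ β := by rw [mul_assoc, e]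
      _ ≤ η * c * ε ^ β := by gcongr
      _ = η * (c * ε ^ β) := by ring
      _ ≤ u * h u := mul_le_mul hu.1
          ((mul_le_mul_of_nonneg_left (by linarith [hu.2]) hc.le).trans (hch u hu01))
          (by positivity) hu01.1
  rw [drift_eq hε]
  have h2 : K + F ≤ ε⁻¹ * (u * h u) := by
    rw [inv_mul_eq_div, le_div_iff₀ hε]; exact h1
  linarith [neg_abs_le (f u), hfF u hu01]

/-! ### The deterministic flow and its hitting times. -/

theorem IsFlow.continuousOn {f h : ℝ → ℝ} {ε : ℝ} {x : ℝ → ℝ} (hx : IsFlow f h ε x) :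
    ContinuousOn x (Ici 0) :=
  fun t ht => (hx.ode t ht).continuousWithinAt

theorem IsFlow.hasDerivWithinAt {f h : ℝ → ℝ} {ε : ℝ} {x : ℝ → ℝ} (hx : IsFlow f h ε x) {t : ℝ}
    (ht : 0 ≤ t) : HasDerivWithinAt x (drift f h ε (x t)) (Ici t) t :=
  (hx.ode t ht).mono (Ici_subset_Ici.2 ht)

/-- A linear lower barrier for the flow. -/
theorem IsFlow.le_of_le_drift {f h : ℝ → ℝ} {ε : ℝ} {x : ℝ → ℝ} (hx : IsFlow f h ε x)
    {s u v c d : ℝ} (hs : 0 ≤ s) (hus : u ≤ x s) (huv : u ≤ v) (hc : 0 < c) (hcd : c < d)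
    (hV : ∀ w ∈ Icc u v, d ≤ drift f h ε w) : v ≤ x (s + (v - u) / c) := by
  have hlen : 0 ≤ (v - u) / c := div_nonneg (by linarith) hc.le
  -- The line of slope `c < d` cannot cross the flow: slopes need comparing only at contact points,
  -- where the flow lies in `[u, v]` and has speed at least `d`.
  have := image_le_of_deriv_right_lt_deriv_boundary' (f := fun t => u + c * (t - s))
    (f' := fun _ => c) (a := s) (b := s + (v - u) / c) (B := x)
    (B' := fun t => drift f h ε (x t)) (by fun_prop)
    (fun t _ => by
      simpa using ((((hasDerivAt_id t).sub_const s).const_mul c).const_add u).hasDerivWithinAt)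
    (by simpa using hus) (hx.continuousOn.mono fun t ht => hs.trans ht.1)
    (fun t ht => hx.hasDerivWithinAt (hs.trans ht.1))
    (fun t ht he => hcd.trans_le (hV _ (by
      rw [← he]
      have h1 : t - s ≤ (v - u) / c := by linarith [ht.2]
      rw [le_div_iff₀ hc] at h1
      have h2 := mul_nonneg hc.le (sub_nonneg.2 ht.1)
      constructor <;> linarith)))
  have h := this (right_mem_Icc.2 (by linarith))
  have e : c * (s + (v - u) / c - s) = v - u := by field_simp; ring
  simp only [e] at h
  linarith

/-- The first time at which the flow reaches the level `y`. -/
noncomputable def hitTime (x : ℝ → ℝ) (y : ℝ) : ℝ := sInf {s | 0 ≤ s ∧ y ≤ x s}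

theorem hitTime_le {x : ℝ → ℝ} {y t : ℝ} (ht : 0 ≤ t) (hy : y ≤ x t) : hitTime x y ≤ t :=
  csInf_le ⟨0, fun _ h => h.1⟩ ⟨ht, hy⟩

theorem hitTime_nonneg (x : ℝ → ℝ) (y : ℝ) : 0 ≤ hitTime x y :=
  Real.sInf_nonneg fun _ h => h.1

theorem lt_of_lt_hitTime {x : ℝ → ℝ} {y t : ℝ} (ht : 0 ≤ t) (h : t < hitTime x y) : x t < y := by
  by_contra! hc
  exact absurd (hitTime_le ht hc) (not_le.2 h)

theorem IsFlow.map_hitTime {f h : ℝ → ℝ} {ε : ℝ} {x : ℝ → ℝ} (hx : IsFlow f h ε x) {y t : ℝ}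
    (hy : 0 ≤ y) (ht : 0 ≤ t) (hyt : y ≤ x t) : x (hitTime x y) = y := by
  have hcl : IsClosed {s | 0 ≤ s ∧ y ≤ x s} := by
    have := hx.continuousOn.preimage_isClosed_of_isClosed isClosed_Ici (isClosed_Ici (a := y))
    exact this
  have hmem : hitTime x y ∈ {s | 0 ≤ s ∧ y ≤ x s} :=
    hcl.csInf_mem ⟨t, ht, hyt⟩ ⟨0, fun _ h => h.1⟩
  refine le_antisymm ?_ hmem.2
  obtain ⟨s, hs, hsy⟩ := intermediate_value_Icc hmem.1
    (hx.continuousOn.mono fun s hs => hs.1) ⟨by rw [hx.init]; exact hy, hmem.2⟩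
  have := hitTime_le hs.1 hsy.ge
  rw [← le_antisymm hs.2 this, hsy]

theorem IsFlow.strictMonoOn {f h : ℝ → ℝ} {ε : ℝ} {x : ℝ → ℝ} (hx : IsFlow f h ε x) {y : ℝ}
    (hV : ∀ w ∈ Icc 0 y, 0 < drift f h ε w) : StrictMonoOn x (Icc 0 (hitTime x y)) := by
  refine strictMonoOn_of_deriv_pos (convex_Icc _ _) (hx.continuousOn.mono fun s hs => hs.1)
    fun t ht => ?_
  rw [interior_Icc] at ht
  rw [((hx.ode t ht.1.le).hasDerivAt (Ici_mem_nhds ht.1)).deriv]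
  exact hV _ ⟨(hx.mem_Icc t ht.1.le).1, (lt_of_lt_hitTime ht.1.le ht.2).le⟩

/-- A jump requires the threshold to be strictly exceeded, so reaching it is not enough: the flow
must cross it at once. -/
theorem IsFlow.exists_lt {f h : ℝ → ℝ} {ε : ℝ} {x : ℝ → ℝ} (hx : IsFlow f h ε x) {t : ℝ}
    (ht : 0 ≤ t) (hV : 0 < drift f h ε (x t)) : ∀ᶠ s in 𝓝[>] t, x t < x s := by
  have h1 := hx.hasDerivWithinAt ht
  rw [hasDerivWithinAt_iff_tendsto_slope, Ici_sdiff_left] at h1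
  filter_upwards [h1.eventually_const_lt hV, self_mem_nhdsWithin] with s hs (hst : t < s)
  rw [slope_def_field] at hs
  have := (div_pos_iff_of_pos_right (sub_pos.2 hst)).1 hs
  linarith

/-- The properties of the time `T` at which the flow reaches `y`. -/
structure IsHit (x : ℝ → ℝ) (y T : ℝ) : Prop where
  pos : 0 < T
  map_eq : x T = y
  strictMonoOn : StrictMonoOn x (Icc 0 T)
  lt_after : ∀ᶠ s in 𝓝[>] T, y < x s

theorem eventually_isHit {f h : ℝ → ℝ} (hfh : Coefficients f h) {β : ℝ}
    (hβ : β ∈ Ioo (0 : ℝ) (1 / 2)) {x : ℝ → ℝ → ℝ} (hx : ∀ ε : ℝ, 0 < ε → IsFlow f h ε (x ε))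
    {η : ℝ} (hη : 0 < η) :
    ∀ᶠ ε in 𝓝[>] (0 : ℝ), IsHit (x ε) (1 - ε ^ β) (hitTime (x ε) (1 - ε ^ β)) ∧
      hitTime (x ε) (1 - ε ^ β) ≤ (4 / f 0 + 2) * η := by
  have hf0 := hfh.f_zero_pos
  obtain ⟨δ, hδ, hfδ⟩ := hfh.exists_close (half_pos hf0)
  -- Below `δ` the speed is at least `f 0 / 2`, below `η` the climb to `ρ` takes a time of order
  -- `η`, and `1/2` keeps `ρ` under the threshold. From `ρ` on, the speed is at least `ρ⁻¹`, so the
  -- rest also takes a time of order `ρ`.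
  set ρ := min (min δ η) (1 / 2)
  have hρ : 0 < ρ := by positivity
  have hρη : ρ ≤ η := (min_le_left _ _).trans (min_le_right _ _)
  have hlim : Tendsto (fun ε : ℝ => ε ^ β) (𝓝[>] 0) (𝓝 0) := by
    have h2 := (Real.continuousAt_rpow_const 0 β (Or.inr hβ.1.le)).tendsto
    rw [Real.zero_rpow hβ.1.ne'] at h2
    exact h2.mono_left nhdsWithin_le_nhds
  filter_upwards [self_mem_nhdsWithin, hfh.eventually_le_drift hβ hρ ρ⁻¹,
    hlim.eventually_lt_const (show (0 : ℝ) < 1 / 2 by norm_num)] with ε (hε : 0 < ε) hV hlt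
  have hp : 0 < ε ^ β := Real.rpow_pos_of_pos hε _
  set y := 1 - ε ^ β
  have hρy : ρ ≤ y := (min_le_right _ _).trans (by simp only [y]; linarith)
  have hV0 : ∀ w ∈ Icc 0 ρ, f 0 / 2 ≤ drift f h ε w := fun w hw => by
    have hw1 : w ∈ Icc (0 : ℝ) 1 := ⟨hw.1, hw.2.trans ((min_le_right _ _).trans (by norm_num))⟩
    have := hfδ w hw1 (hw.2.trans ((min_le_left _ _).trans (min_le_left _ _)))
    have := (abs_le.1 this).1
    linarith [hfh.le_drift hε hw1]
  have h1 := (hx ε hε).le_of_le_drift le_rfl (hx ε hε).init.ge hρ.le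
    (c := f 0 / 4) (by positivity) (by linarith) hV0
  have h2 := (hx ε hε).le_of_le_drift (by positivity) h1 hρy (c := ρ⁻¹ / 2) (by positivity)
    (half_lt_self (inv_pos.2 hρ)) hV
  set t := 0 + (ρ - 0) / (f 0 / 4) + (y - ρ) / (ρ⁻¹ / 2)
  have ht0 : 0 ≤ t := add_nonneg (by positivity) (div_nonneg (by linarith) (by positivity))
  have hmap := (hx ε hε).map_hitTime (hρ.le.trans hρy) ht0 h2
  have hVpos : ∀ w ∈ Icc 0 y, 0 < drift f h ε w := fun w hw => by
    rcases le_total w ρ with hle | hge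
    · exact (half_pos hf0).trans_le (hV0 w ⟨hw.1, hle⟩)
    · exact (inv_pos.2 hρ).trans_le (hV w ⟨hge, hw.2⟩)
  refine ⟨⟨?_, hmap, (hx ε hε).strictMonoOn hVpos, ?_⟩, (hitTime_le ht0 h2).trans ?_⟩
  · rcases (hitTime_nonneg (x ε) y).lt_or_eq with h | h
    · exact h
    · rw [← h, (hx ε hε).init] at hmap
      linarith
  · have := (hx ε hε).exists_lt (hitTime_nonneg (x ε) y) (by
      rw [hmap]; exact hVpos _ ⟨hρ.le.trans hρy, le_rfl⟩)
    rwa [hmap] at this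
  · calc t = 4 / f 0 * ρ + 2 * (y - ρ) * ρ := by simp only [t]; field_simp; ring
      _ ≤ 4 / f 0 * ρ + 2 * 1 * ρ := by gcongr; simp only [y]; linarith
      _ = (4 / f 0 + 2) * ρ := by ring
      _ ≤ _ := by gcongr

theorem tendsto_hitTime {f h : ℝ → ℝ} (hfh : Coefficients f h) {β : ℝ}
    (hβ : β ∈ Ioo (0 : ℝ) (1 / 2)) {x : ℝ → ℝ → ℝ} (hx : ∀ ε : ℝ, 0 < ε → IsFlow f h ε (x ε)) :
    Tendsto (fun ε => hitTime (x ε) (1 - ε ^ β)) (𝓝[>] 0) (𝓝 0) := by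
  have hf0 := hfh.f_zero_pos
  refine tendsto_order.2 ⟨fun a ha => Eventually.of_forall fun ε =>
    ha.trans_le (hitTime_nonneg _ _), fun a ha => ?_⟩
  have hC : 0 < 4 / f 0 + 2 := by positivity
  filter_upwards [eventually_isHit hfh hβ hx (η := a / (4 / f 0 + 2) / 2) (by positivity)]
    with ε hε
  refine hε.2.trans_lt ?_
  rw [mul_div_assoc', mul_div_cancel₀ _ hC.ne']
  linarith

/-! ### The tail of the waiting times and the rate of reaching a level. -/

/-- The tail of a waiting time: the probability that no reset occurs before time `t`. -/
noncomputable def survival (h : ℝ → ℝ) (ε : ℝ) (x : ℝ → ℝ) (t : ℝ) : ℝ :=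
  Real.exp (-(ε⁻¹ * ∫ s in (0 : ℝ)..t, h (x s)))

theorem survival_pos (h : ℝ → ℝ) (ε : ℝ) (x : ℝ → ℝ) (t : ℝ) : 0 < survival h ε x t :=
  Real.exp_pos _

@[simp]
theorem survival_zero (h : ℝ → ℝ) (ε : ℝ) (x : ℝ → ℝ) : survival h ε x 0 = 1 := by
  simp [survival]

/-- The flow is controlled only for nonnegative times; freezing it before time `0` gives a globally
continuous integrand with the same integrals over `[0, t]`. -/
theorem IsFlow.continuous_comp {f h : ℝ → ℝ} (hfh : Coefficients f h) {ε : ℝ} {x : ℝ → ℝ}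
    (hx : IsFlow f h ε x) : Continuous fun s => h (x (max s 0)) :=
  hfh.contDiff_h.continuousOn.comp_continuous
    (hx.continuousOn.comp_continuous (by fun_prop) fun s => le_max_right s 0)
    fun s => hx.mem_Icc _ (le_max_right s 0)

theorem survival_eq (h : ℝ → ℝ) (ε : ℝ) (x : ℝ → ℝ) {t : ℝ} (ht : 0 ≤ t) :
    survival h ε x t = Real.exp (-(ε⁻¹ * ∫ s in (0 : ℝ)..t, h (x (max s 0)))) := by
  unfold survival
  congr 3
  refine intervalIntegral.integral_congr fun s hs => ?_
  rw [uIcc_of_le ht] at hs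
  simp [max_eq_left hs.1]

theorem IsFlow.continuousOn_survival {f h : ℝ → ℝ} (hfh : Coefficients f h) {ε : ℝ} {x : ℝ → ℝ}
    (hx : IsFlow f h ε x) : ContinuousOn (survival h ε x) (Ici 0) := by
  refine ContinuousOn.congr (Continuous.continuousOn ?_) fun t ht => survival_eq h ε x ht
  have := intervalIntegral.continuous_primitive (μ := volume)
    (fun a b => (hx.continuous_comp hfh).intervalIntegrable a b) 0
  fun_prop

theorem IsFlow.hasDerivAt_survival {f h : ℝ → ℝ} (hfh : Coefficients f h) {ε : ℝ} {x : ℝ → ℝ}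
    (hx : IsFlow f h ε x) {t : ℝ} (ht : 0 < t) :
    HasDerivAt (survival h ε x) (-(ε⁻¹ * h (x t)) * survival h ε x t) t := by
  have h1 := ((hx.continuous_comp hfh).integral_hasStrictDerivAt 0 t).hasDerivAt
  have h2 : HasDerivAt (fun t => Real.exp (-(ε⁻¹ * ∫ s in (0 : ℝ)..t, h (x (max s 0)))))
      (Real.exp (-(ε⁻¹ * ∫ s in (0 : ℝ)..t, h (x (max s 0)))) * -(ε⁻¹ * h (x (max t 0)))) t :=
    ((h1.const_mul ε⁻¹).neg).exp
  rw [← survival_eq h ε x ht.le, max_eq_left ht.le] at h2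
  rw [mul_comm]
  refine h2.congr_of_eventuallyEq ?_
  filter_upwards [Ioi_mem_nhds ht] with s hs using survival_eq h ε x (le_of_lt hs)

theorem IsFlow.antitoneOn_survival {f h : ℝ → ℝ} (hfh : Coefficients f h) {ε : ℝ} {x : ℝ → ℝ}
    (hε : 0 < ε) (hx : IsFlow f h ε x) : AntitoneOn (survival h ε x) (Ici 0) := by
  refine antitoneOn_of_deriv_nonpos (convex_Ici 0) (hx.continuousOn_survival hfh) ?_ ?_
  · rw [interior_Ici]
    exact fun t ht => (hx.hasDerivAt_survival hfh ht).differentiableAt.differentiableWithinAt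
  · rw [interior_Ici]
    intro t (ht : 0 < t)
    rw [(hx.hasDerivAt_survival hfh ht).deriv]
    have := hfh.h_nonneg (hx.mem_Icc t ht.le)
    have := survival_pos h ε x t
    rw [neg_mul, neg_nonpos]
    positivity

theorem IsFlow.continuousOn_comp_mul_survival {f h : ℝ → ℝ} (hfh : Coefficients f h) {ε : ℝ}
    {x : ℝ → ℝ} (hx : IsFlow f h ε x) :
    ContinuousOn (fun s => f (x s) * survival h ε x s) (Ici 0) :=
  (hfh.contDiff_f.continuousOn.comp hx.continuousOn hx.mem_Icc).mul (hx.continuousOn_survival hfh)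

/-- The martingale identity for the flow killed at the first reset. -/
theorem IsFlow.mul_survival {f h : ℝ → ℝ} (hfh : Coefficients f h) {ε : ℝ} (hε : 0 < ε)
    {x : ℝ → ℝ} (hx : IsFlow f h ε x) {t : ℝ} (ht : 0 ≤ t) :
    x t * survival h ε x t = ∫ s in (0 : ℝ)..t, f (x s) * survival h ε x s := by
  rw [intervalIntegral.integral_eq_sub_of_hasDeriv_right_of_le ht
    (f := fun t => x t * survival h ε x t)]
  · simp [hx.init]
  · exact (hx.continuousOn.mul (hx.continuousOn_survival hfh)).mono fun s hs => hs.1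
  · intro s hs
    have h1 := ((hx.ode s hs.1.le).hasDerivAt (Ici_mem_nhds hs.1)).mul
      (hx.hasDerivAt_survival hfh hs.1)
    -- The terms `± ε⁻¹ x h(x) S` cancel.
    convert! h1.hasDerivWithinAt using 1
    field_simp
    ring
  · refine ContinuousOn.intervalIntegrable ?_
    rw [uIcc_of_le ht]
    exact (hx.continuousOn_comp_mul_survival hfh).mono fun s hs => hs.1

/-- The identity for `x S` first yields `x S ≤ F m`, so `S ≤ F m / δ` wherever `x > δ`: such times
contribute `O(T m)`, while at the others `f(x)` is within `η` of `f 0`. Likewise `S ≤ F m / u` after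
`θ`, so extending the integral of `S` from `θ` to `T` costs `O(T m)`. -/
theorem IsFlow.abs_mul_survival_sub_le {f h : ℝ → ℝ} (hfh : Coefficients f h) {ε : ℝ}
    (hε : 0 < ε) {x : ℝ → ℝ} (hx : IsFlow f h ε x) {F η δ u θ T : ℝ}
    (hF : ∀ u ∈ Icc (0 : ℝ) 1, |f u| ≤ F) (hη : 0 ≤ η) (hδ : 0 < δ)
    (hfδ : ∀ u ∈ Icc (0 : ℝ) 1, u ≤ δ → |f u - f 0| ≤ η)
    (hu : 0 < u) (hθ : 0 ≤ θ) (hθT : θ ≤ T) (hxθ : x θ = u) (hxu : ∀ s ∈ Icc θ T, u ≤ x s) :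
    |u * survival h ε x θ - f 0 * ∫ s in (0 : ℝ)..T, survival h ε x s| ≤
      (η + (2 * F ^ 2 / δ + F ^ 2 / u) * T) * ∫ s in (0 : ℝ)..T, survival h ε x s := by
  set S := survival h ε x
  set m := ∫ s in (0 : ℝ)..T, S s with hm
  have hT : 0 ≤ T := hθ.trans hθT
  have hS0 : ∀ s, 0 < S s := survival_pos h ε x
  have hF0 : 0 ≤ F := (abs_nonneg _).trans (hF 0 (by simp))
  have int_S : ∀ a b : ℝ, 0 ≤ a → a ≤ b → IntervalIntegrable S volume a b := fun a b ha hab => by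
    refine ContinuousOn.intervalIntegrable ?_
    rw [uIcc_of_le hab]
    exact (hx.continuousOn_survival hfh).mono fun s hs => ha.trans hs.1
  have int_fS : ∀ a b : ℝ, 0 ≤ a → a ≤ b →
      IntervalIntegrable (fun s => f (x s) * S s) volume a b := fun a b ha hab => by
    refine ContinuousOn.intervalIntegrable ?_
    rw [uIcc_of_le hab]
    exact (hx.continuousOn_comp_mul_survival hfh).mono fun s hs => ha.trans hs.1
  have hm0 : 0 ≤ m := intervalIntegral.integral_nonneg hT fun s _ => (hS0 s).le
  have hxS : ∀ s ∈ Icc 0 T, x s * S s ≤ F * m := fun s hs => by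
    rw [hx.mul_survival hfh hε hs.1, ← intervalIntegral.integral_const_mul]
    calc _ ≤ ∫ r in (0 : ℝ)..s, F * S r :=
          intervalIntegral.integral_mono_on hs.1 (int_fS 0 s le_rfl hs.1)
            ((int_S 0 s le_rfl hs.1).const_mul F) fun r hr =>
            mul_le_mul_of_nonneg_right ((le_abs_self _).trans (hF _ (hx.mem_Icc r hr.1)))
              (hS0 r).le
      _ ≤ _ := by
          rw [← intervalIntegral.integral_add_adjacent_intervals
            ((int_S 0 s le_rfl hs.1).const_mul F) ((int_S s T hs.1 hs.2).const_mul F)]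
          have : 0 ≤ ∫ r in s..T, F * S r :=
            intervalIntegral.integral_nonneg hs.2 fun r _ => mul_nonneg hF0 (hS0 r).le
          linarith
  have e : u * S θ - f 0 * m =
      (∫ s in (0 : ℝ)..θ, (f (x s) * S s - f 0 * S s)) - ∫ s in θ..T, f 0 * S s := by
    rw [intervalIntegral.integral_sub (int_fS 0 θ le_rfl hθ) ((int_S 0 θ le_rfl hθ).const_mul _),
      ← hx.mul_survival hfh hε hθ, hxθ, hm,
      ← intervalIntegral.integral_add_adjacent_intervals (int_S 0 θ le_rfl hθ)
      (int_S θ T hθ hθT), intervalIntegral.integral_const_mul,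
      intervalIntegral.integral_const_mul]
    ring
  have b1 : |∫ s in (0 : ℝ)..θ, (f (x s) * S s - f 0 * S s)| ≤ η * m + 2 * F ^ 2 / δ * T * m := by
    calc _ ≤ ∫ s in (0 : ℝ)..θ, (η * S s + 2 * F * (F * m / δ)) := by
          rw [← Real.norm_eq_abs]
          refine intervalIntegral.norm_integral_le_of_norm_le hθ (ae_of_all _ fun s hs => ?_)
            (((int_S 0 θ le_rfl hθ).const_mul η).add intervalIntegrable_const)
          have hs01 := hx.mem_Icc s hs.1.le
          rw [← sub_mul, norm_mul, Real.norm_eq_abs, Real.norm_of_nonneg (hS0 s).le]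
          rcases le_or_gt (x s) δ with hle | hgt
          · have := mul_le_mul_of_nonneg_right (hfδ _ hs01 hle) (hS0 s).le
            have : 0 ≤ 2 * F * (F * m / δ) := by positivity
            linarith
          · have h1 : |f (x s) - f 0| ≤ 2 * F := by
              have := abs_sub (f (x s)) (f 0)
              linarith [hF _ hs01, hF 0 (by simp)]
            have h2 : S s ≤ F * m / δ := by
              rw [le_div_iff₀ hδ]
              have := mul_le_mul_of_nonneg_right hgt.le (hS0 s).le
              linarith [hxS s ⟨hs.1.le, hs.2.trans hθT⟩]
            have := mul_le_mul h1 h2 (hS0 s).le (by positivity)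
            have := mul_nonneg hη (hS0 s).le
            linarith
      _ ≤ ∫ s in (0 : ℝ)..T, (η * S s + 2 * F * (F * m / δ)) := by
          rw [← intervalIntegral.integral_add_adjacent_intervals
            (((int_S 0 θ le_rfl hθ).const_mul η).add intervalIntegrable_const)
            (((int_S θ T hθ hθT).const_mul η).add intervalIntegrable_const)]
          have : 0 ≤ ∫ s in θ..T, (η * S s + 2 * F * (F * m / δ)) :=
            intervalIntegral.integral_nonneg hθT fun r _ => by
              have := hS0 r
              positivity
          linarith
      _ = _ := by
          rw [intervalIntegral.integral_add ((int_S 0 T le_rfl hT).const_mul η)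
            intervalIntegrable_const, intervalIntegral.integral_const_mul,
            intervalIntegral.integral_const, smul_eq_mul, ← hm]
          ring
  have b2 : |∫ s in θ..T, f 0 * S s| ≤ F ^ 2 / u * T * m := by
    calc _ ≤ F * (F * m / u) * |T - θ| := by
          rw [← Real.norm_eq_abs]
          refine intervalIntegral.norm_integral_le_of_norm_le_const fun s hs => ?_
          rw [uIoc_of_le hθT] at hs
          rw [norm_mul, Real.norm_eq_abs, Real.norm_of_nonneg (hS0 s).le]
          refine mul_le_mul (hF 0 (by simp)) ?_ (hS0 s).le hF0
          rw [le_div_iff₀ hu]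
          have := mul_le_mul_of_nonneg_right (hxu s ⟨hs.1.le, hs.2⟩) (hS0 s).le
          linarith [hxS s ⟨hθ.trans hs.1.le, hs.2⟩]
      _ ≤ F * (F * m / u) * T := by
          rw [abs_of_nonneg (by linarith)]
          gcongr
          linarith
      _ = _ := by ring
  rw [e]
  calc _ ≤ _ := abs_sub _ _
    _ ≤ _ := add_le_add b1 b2
    _ = _ := by ring

theorem tendsto_one_sub_rpow {β : ℝ} (hβ : 0 < β) :
    Tendsto (fun ε : ℝ => 1 - ε ^ β) (𝓝[>] 0) (𝓝 1) := by
  have h2 := (Real.continuousAt_rpow_const 0 β (Or.inr hβ.le)).tendsto.const_sub 1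
  simp only [Real.zero_rpow hβ.ne', sub_zero] at h2
  exact h2.mono_left nhdsWithin_le_nhds

/-- The mean of a waiting time truncated at the time at which the level `1 - ε ^ β` is reached. -/
noncomputable def meanTime (h : ℝ → ℝ) (β ε : ℝ) (x : ℝ → ℝ) : ℝ :=
  ∫ s in (0 : ℝ)..hitTime x (1 - ε ^ β), survival h ε x s

theorem IsFlow.meanTime_pos {f h : ℝ → ℝ} (hfh : Coefficients f h) {β ε : ℝ} {x : ℝ → ℝ}
    (hx : IsFlow f h ε x) (hT : 0 < hitTime x (1 - ε ^ β)) : 0 < meanTime h β ε x := by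
  refine intervalIntegral.intervalIntegral_pos_of_pos_on ?_ (fun s _ => survival_pos h ε x s) hT
  refine ContinuousOn.intervalIntegrable ?_
  rw [uIcc_of_le hT.le]
  exact (hx.continuousOn_survival hfh).mono fun s hs => hs.1

theorem IsFlow.meanTime_le {f h : ℝ → ℝ} (hfh : Coefficients f h) {β ε : ℝ} (hε : 0 < ε)
    {x : ℝ → ℝ} (hx : IsFlow f h ε x) (hT : 0 < hitTime x (1 - ε ^ β)) :
    meanTime h β ε x ≤ hitTime x (1 - ε ^ β) := by
  have h1 : IntervalIntegrable (survival h ε x) volume 0 (hitTime x (1 - ε ^ β)) := by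
    refine ContinuousOn.intervalIntegrable ?_
    rw [uIcc_of_le hT.le]
    exact (hx.continuousOn_survival hfh).mono fun s hs => hs.1
  calc _ ≤ ∫ s in (0 : ℝ)..hitTime x (1 - ε ^ β), (1 : ℝ) :=
        intervalIntegral.integral_mono_on hT.le h1 intervalIntegrable_const fun s hs => by
          rw [← survival_zero h ε x]
          exact hx.antitoneOn_survival hfh hε (mem_Ici.2 le_rfl) hs.1 hs.1
    _ = _ := by simp

theorem hitTime_mono {x : ℝ → ℝ} {y z t : ℝ} (hyz : y ≤ z) (ht : 0 ≤ t) (hz : z ≤ x t) :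
    hitTime x y ≤ hitTime x z :=
  csInf_le_csInf ⟨0, fun _ h => h.1⟩ ⟨t, ht, hz⟩ fun _ h => ⟨h.1, hyz.trans h.2⟩

theorem eventually_hit {f h : ℝ → ℝ} (hfh : Coefficients f h) {β : ℝ}
    (hβ : β ∈ Ioo (0 : ℝ) (1 / 2)) {x : ℝ → ℝ → ℝ} (hx : ∀ ε : ℝ, 0 < ε → IsFlow f h ε (x ε)) :
    ∀ᶠ ε in 𝓝[>] (0 : ℝ), IsHit (x ε) (1 - ε ^ β) (hitTime (x ε) (1 - ε ^ β)) :=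
  (eventually_isHit hfh hβ hx one_pos).mono fun _ h => h.1

/-- The probability that an excursion reaches the level `u`, per unit of mean time, tends to
`f 0 / u`. -/
theorem tendsto_survival_div {f h : ℝ → ℝ} (hfh : Coefficients f h) {β : ℝ}
    (hβ : β ∈ Ioo (0 : ℝ) (1 / 2)) {x : ℝ → ℝ → ℝ} (hx : ∀ ε : ℝ, 0 < ε → IsFlow f h ε (x ε))
    {u : ℝ} (hu : 0 < u) (hu1 : u ≤ 1) :
    Tendsto (fun ε => survival h ε (x ε) (hitTime (x ε) (min u (1 - ε ^ β))) /
      meanTime h β ε (x ε)) (𝓝[>] 0) (𝓝 (f 0 / u)) := by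
  obtain ⟨F, hF0, hF⟩ := hfh.exists_bound
  have hT := tendsto_hitTime hfh hβ hx
  have hmin : Tendsto (fun ε : ℝ => min u (1 - ε ^ β)) (𝓝[>] 0) (𝓝 u) := by
    have := (tendsto_const_nhds (x := u)).min (tendsto_one_sub_rpow hβ.1)
    rwa [min_eq_left hu1] at this
  -- The level is capped at the threshold because `u = 1` is allowed and the flow is only known to
  -- reach `1 - ε ^ β`.
  have key : Tendsto (fun ε => min u (1 - ε ^ β) *
      (survival h ε (x ε) (hitTime (x ε) (min u (1 - ε ^ β))) / meanTime h β ε (x ε)))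
      (𝓝[>] 0) (𝓝 (f 0)) := by
    rw [Metric.tendsto_nhds]
    intro η hη
    obtain ⟨δ, hδ, hfδ⟩ := hfh.exists_close (half_pos hη)
    have hlim : Tendsto (fun ε => η / 2 + (2 * F ^ 2 / δ + F ^ 2 / min u (1 - ε ^ β)) *
        hitTime (x ε) (1 - ε ^ β)) (𝓝[>] 0) (𝓝 (η / 2)) := by
      have := (((tendsto_const_nhds (x := F ^ 2)).div hmin hu.ne').const_add
        (2 * F ^ 2 / δ)).mul hT |>.const_add (η / 2)
      simpa using this
    filter_upwards [self_mem_nhdsWithin, eventually_hit hfh hβ hx,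
      hlim.eventually_lt_const (half_lt_self hη), hmin.eventually_const_lt hu]
      with ε (hε : 0 < ε) hhit hlt hpos
    have hm := (hx ε hε).meanTime_pos hfh hhit.pos
    have hle : min u (1 - ε ^ β) ≤ x ε (hitTime (x ε) (1 - ε ^ β)) := by
      rw [hhit.map_eq]; exact min_le_right _ _
    have hθT := hitTime_le hhit.pos.le hle
    have hθ0 := hitTime_nonneg (x ε) (min u (1 - ε ^ β))
    have hxθ := (hx ε hε).map_hitTime hpos.le hhit.pos.le hle
    have := (hx ε hε).abs_mul_survival_sub_le hfh hε hF (half_pos hη).le hδ hfδ hpos hθ0 hθT hxθ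
      fun s hs => by
        rw [← hxθ]
        exact hhit.strictMonoOn.monotoneOn ⟨hθ0, hθT⟩ ⟨hθ0.trans hs.1, hs.2⟩ hs.1
    change |_ - f 0 * meanTime h β ε (x ε)| ≤ _ * meanTime h β ε (x ε) at this
    rw [Real.dist_eq]
    refine lt_of_le_of_lt ?_ hlt
    rw [← div_le_iff₀ hm, ← abs_of_pos hm, ← abs_div, abs_of_pos hm] at this
    convert! this using 2
    field_simp
  have := key.div hmin hu.ne'
  refine this.congr' ?_
  filter_upwards [hmin.eventually_const_lt hu] with ε hpos
  simp only [Pi.div_apply]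
  field_simp

/-! ### Pathwise description of the jump and of the pre-spikes. -/

theorem resetTime_succ (s : ℕ → ℝ) (n : ℕ) : resetTime s (n + 1) = resetTime s n + s n :=
  Finset.sum_range_succ _ _

@[simp]
theorem resetTime_zero (s : ℕ → ℝ) : resetTime s 0 = 0 := Finset.sum_range_zero _

theorem strictMono_resetTime {s : ℕ → ℝ} (hs : ∀ n, 0 < s n) : StrictMono (resetTime s) :=
  strictMono_nat_of_lt_succ fun n => by rw [resetTime_succ]; linarith [hs n]

theorem resetTime_nonneg {s : ℕ → ℝ} (hs : ∀ n, 0 < s n) (n : ℕ) : 0 ≤ resetTime s n :=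
  Finset.sum_nonneg fun i _ => (hs i).le

theorem resetIndex_eq {s : ℕ → ℝ} (hs : ∀ n, 0 < s n) {t : ℝ} {n : ℕ} (h1 : resetTime s n ≤ t)
    (h2 : t < resetTime s (n + 1)) : resetIndex s t = n := by
  have : {k : ℕ | resetTime s k ≤ t} = Iic n := by
    ext k
    refine ⟨fun hk => Nat.lt_succ_iff.1 ((strictMono_resetTime hs).lt_iff_lt.1
      (lt_of_le_of_lt hk h2)), fun hk => ((strictMono_resetTime hs).monotone hk).trans h1⟩
  rw [resetIndex, this, csSup_Iic]

theorem process_eq (x : ℝ → ℝ) {s : ℕ → ℝ} (hs : ∀ n, 0 < s n) {t : ℝ} {n : ℕ}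
    (h1 : resetTime s n ≤ t) (h2 : t < resetTime s (n + 1)) :
    process x s t = x (t - resetTime s n) := by
  rw [process, resetIndex_eq hs h1 h2]

theorem leftLim_process {x : ℝ → ℝ} (hx : ContinuousOn x (Ici 0)) {s : ℕ → ℝ}
    (hs : ∀ n, 0 < s n) (n : ℕ) :
    Function.leftLim (process x s) (resetTime s (n + 1)) = x (s n) := by
  refine leftLim_eq_of_tendsto ?_
  have hlt : resetTime s n < resetTime s (n + 1) := strictMono_resetTime hs n.lt_succ_self
  have h1 : Tendsto (fun t => t - resetTime s n) (𝓝 (resetTime s (n + 1))) (𝓝 (s n)) := by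
    have : ContinuousAt (fun t => t - resetTime s n) (resetTime s (n + 1)) := by fun_prop
    have h := this.tendsto
    simpa [resetTime_succ] using h
  refine (((hx.continuousAt (Ici_mem_nhds (hs n))).tendsto.comp h1).mono_left
    nhdsWithin_le_nhds).congr' ?_
  filter_upwards [Ioo_mem_nhdsLT hlt] with t ht
  exact (process_eq x hs ht.1.le ht.2).symm

/-- Reset times are distinct, so counting points loses no multiplicity. With waiting times indexed
from `0`, excursion `n` ends at reset `n + 1`. -/
theorem preSpikeCount_eq {x : ℝ → ℝ} (hx : ContinuousOn x (Ici 0)) {s : ℕ → ℝ}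
    (hs : ∀ n, 0 < s n) (I A : Set ℝ) :
    preSpikeCount x s I A = {n | resetTime s (n + 1) ∈ I ∧ x (s n) ∈ A}.encard := by
  have hinj : Function.Injective fun n => (resetTime s (n + 1), x (s n)) := fun m n hmn =>
    Nat.succ_injective ((strictMono_resetTime hs).injective (congrArg Prod.fst hmn))
  rw [preSpikeCount, ← hinj.encard_image]
  congr 1
  ext p
  simp only [preSpikes, mem_inter_iff, mem_ofPred_eq, mem_image, mem_prod]
  constructor
  · rintro ⟨⟨i, hi, rfl⟩, h1, h2⟩
    obtain ⟨n, rfl⟩ := Nat.exists_eq_add_of_le' hi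
    rw [leftLim_process hx hs] at *
    exact ⟨n, ⟨h1, h2⟩, rfl⟩
  · rintro ⟨n, h, rfl⟩
    exact ⟨⟨n + 1, by omega, by rw [leftLim_process hx hs]⟩, h⟩

theorem exists_resetTime_le_lt (s : ℕ → ℝ) {t : ℝ} (ht : 0 ≤ t) {M : ℕ}
    (hM : t < resetTime s M) : ∃ n, resetTime s n ≤ t ∧ t < resetTime s (n + 1) := by
  induction M with
  | zero => simp at hM; linarith
  | succ M ih =>
    rcases le_or_gt (resetTime s M) t with h | h
    · exact ⟨M, h, hM⟩
    · exact ih h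

/-- An excursion stays at or below `y` up to age `T` and exceeds it just after. A jump before `r`
thus needs an excursion longer than `T` that attains age `T` before `r`. The hypothesis `hM` places
every time before `r` inside some excursion. -/
theorem le_firstJump_iff {x : ℝ → ℝ} {y T : ℝ} (hxT : IsHit x y T) {s : ℕ → ℝ}
    (hs : ∀ n, 0 < s n) {r : ℝ} {M : ℕ} (hM : r ≤ resetTime s M) :
    (r : EReal) ≤ firstJump x y s ↔
      ∀ i, resetTime s i < r → s i ≤ T ∨ r ≤ resetTime s i + T := by
  have hle : ∀ t ∈ Icc 0 T, x t ≤ y := fun t ht => by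
    rw [← hxT.map_eq]
    exact hxT.strictMonoOn.monotoneOn ht (right_mem_Icc.2 hxT.pos.le) ht.2
  simp only [firstJump, le_sInf_iff, forall_mem_image, mem_ofPred_eq, EReal.coe_le_coe_iff]
  constructor
  · intro H i hi
    by_contra! hc
    obtain ⟨u, hu1, hu2⟩ := (hxT.lt_after.and (Ioo_mem_nhdsGT
      (show T < min (s i) (r - resetTime s i) from lt_min hc.1 (by linarith [hc.2])))).exists
    have hu0 : 0 < u := hxT.pos.trans hu2.1
    have h2 := lt_min_iff.1 hu2.2
    have := resetTime_nonneg hs i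
    have := H (show 0 ≤ resetTime s i + u ∧ y < process x s (resetTime s i + u) by
      refine ⟨by linarith, ?_⟩
      rw [process_eq x hs (n := i) (by linarith) (by rw [resetTime_succ]; linarith)]
      simpa using hu1)
    linarith
  · intro H t ht
    by_contra! htr
    obtain ⟨n, hn1, hn2⟩ := exists_resetTime_le_lt s ht.1 (htr.trans_le hM)
    have hp := ht.2
    rw [process_eq x hs hn1 hn2] at hp
    rw [resetTime_succ] at hn2
    refine absurd hp (not_lt.2 (hle _ ⟨by linarith, ?_⟩))
    rcases H n (hn1.trans_lt htr) with h | h <;> linarith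

/-- If the first `m` truncated waiting times end well before `r`, the first `k` end after `r`, and
the excursions in between reach neither `A` nor the threshold, then the events up to time `r` are
read off the first `m` waiting times. -/
theorem noJump_and_count_iff {x : ℝ → ℝ} (hx : ContinuousOn x (Ici 0)) {y T : ℝ}
    (hxT : IsHit x y T) {s : ℕ → ℝ} (hs : ∀ n, 0 < s n) {r : ℝ}
    {I A H : Set ℝ} (hI : Ioo 0 r ⊆ I) (hI' : I ⊆ Ioc 0 r)
    (hAH : ∀ n, s n ≤ T → (x (s n) ∈ A ↔ s n ∈ H)) {m k : ℕ}
    (hm : m = 0 ∨ ∑ i ∈ Finset.range m, min (s i) T < r - T)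
    (hk : r < ∑ i ∈ Finset.range k, min (s i) T)
    (hmk : ∀ i, m ≤ i → i < k → s i ≤ T ∧ s i ∉ H) (n : ℕ) :
    ((r : EReal) ≤ firstJump x y s ∧ preSpikeCount x s I A = (n : ℕ∞)) ↔
      ((∀ i < m, s i ≤ T) ∧ {i | i < m ∧ s i ∈ H}.encard = (n : ℕ∞)) := by
  have hkr : r < resetTime s k := hk.trans_le (Finset.sum_le_sum fun i _ => min_le_left _ _)
  have htrunc : ∀ i, (∀ j < i, s j ≤ T) → resetTime s i = ∑ j ∈ Finset.range i, min (s j) T :=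
    fun i hi => Finset.sum_congr rfl fun j hj => (min_eq_left (hi j (Finset.mem_range.1 hj))).symm
  have hmono := strictMono_resetTime hs
  have hT := hxT.pos
  rw [le_firstJump_iff hxT hs hkr.le, preSpikeCount_eq hx hs]
  have hcount : (∀ i < m, s i ≤ T) →
      {i | resetTime s (i + 1) ∈ I ∧ x (s i) ∈ A} = {i | i < m ∧ s i ∈ H} := by
    intro h
    have hall : ∀ i < k, s i ≤ T := fun i hi => by
      rcases lt_or_ge i m with h1 | h1
      · exact h i h1
      · exact (hmk i h1 hi).1
    ext i
    simp only [mem_ofPred_eq]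
    constructor
    · rintro ⟨h1, h2⟩
      have hik : i < k := by
        have := hmono.lt_iff_lt.1 ((hI' h1).2.trans_lt hkr)
        omega
      have hH := (hAH i (hall i hik)).1 h2
      refine ⟨?_, hH⟩
      by_contra! hc
      exact (hmk i hc hik).2 hH
    · rintro ⟨h1, h2⟩
      refine ⟨hI ⟨?_, ?_⟩, (hAH i (h i h1)).2 h2⟩
      · have := resetTime_nonneg hs i
        rw [resetTime_succ]; linarith [hs i]
      · rcases hm with rfl | hm
        · omega
        · rw [← htrunc m h] at hm
          have := hmono.monotone (show i + 1 ≤ m by omega)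
          linarith
  constructor
  · rintro ⟨h1, h2⟩
    have hle : ∀ i < m, s i ≤ T := by
      -- While the earlier excursions are at most `T`, truncation changes nothing, so excursion `i`
      -- starts before `r - T` and an overshoot would show up as a jump before `r`.
      intro i
      induction i using Nat.strong_induction_on with
      | _ i ih =>
        intro hi
        rcases hm with rfl | hm
        · omega
        have h3 := htrunc i fun j hj => ih j hj (hj.trans hi)
        have h4 : ∑ j ∈ Finset.range i, min (s j) T ≤ ∑ j ∈ Finset.range m, min (s j) T :=
          Finset.sum_le_sum_of_subset_of_nonneg (Finset.range_mono hi.le)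
            fun j _ _ => le_min (hs j).le hT.le
        rcases h1 i (by linarith) with h | h
        · exact h
        · linarith
    exact ⟨hle, by rwa [hcount hle] at h2⟩
  · rintro ⟨h1, h2⟩
    refine ⟨fun i hi => Or.inl ?_, by rwa [hcount h1]⟩
    have hik : i < k := hmono.lt_iff_lt.1 (hi.trans hkr)
    rcases lt_or_ge i m with h3 | h3
    · exact h1 i h3
    · exact (hmk i h3 hik).1

/-! ### Probability estimates for finitely many excursions. -/

section Estimates

theorem memLp_min_const {Ω : Type*} [MeasurableSpace Ω] {P : Measure Ω}
    [IsProbabilityMeasure P] {X : Ω → ℝ} (hX : Measurable X) (hpos : ∀ᵐ ω ∂P, 0 < X ω) {T : ℝ}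
    (hT : 0 < T) : MemLp (fun ω => min (X ω) T) 2 P := by
  refine MemLp.of_bound (by fun_prop) T ?_
  filter_upwards [hpos] with ω h
  rw [Real.norm_of_nonneg (le_min h.le hT.le)]
  exact min_le_right _ _

/-- Chebyshev's inequality for sums of truncated waiting times. -/
theorem prob_deviation_le {Ω : Type*} [MeasurableSpace Ω] {P : Measure Ω}
    [IsProbabilityMeasure P] {σ : ℕ → Ω → ℝ} (hσ : ∀ n, Measurable (σ n)) (hind : iIndepFun σ P)
    (hpos : ∀ n, ∀ᵐ ω ∂P, 0 < σ n ω) {T m : ℝ} (hT : 0 < T)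
    (hm : ∀ n, ∫ ω, min (σ n ω) T ∂P = m) (k : ℕ) {c : ℝ} (hc : 0 < c) :
    P.real {ω | c ≤ |∑ i ∈ Finset.range k, min (σ i ω) T - k * m|} ≤ k * m * T / c ^ 2 := by
  set Y : ℕ → Ω → ℝ := fun n ω => min (σ n ω) T
  have hY : ∀ n, MemLp (Y n) 2 P := fun n => memLp_min_const (hσ n) (hpos n) hT
  have hYind : iIndepFun Y P := hind.comp (fun _ u => min u T) fun _ => by fun_prop
  have hvar : variance (∑ i ∈ Finset.range k, Y i) P ≤ k * m * T := by
    rw [IndepFun.variance_sum (fun i _ => hY i) fun i _ j _ hij => hYind.indepFun hij]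
    calc _ ≤ ∑ i ∈ Finset.range k, m * T := Finset.sum_le_sum fun i _ => by
          -- Since `0 ≤ Y ≤ T`, the second moment is at most `T` times the mean.
          refine (variance_le_expectation_sq (hY i).1).trans ?_
          rw [← hm i, ← integral_mul_const]
          refine integral_mono_ae (hY i).integrable_sq
            (((hY i).integrable (by norm_num)).mul_const T) ?_
          filter_upwards [hpos i] with ω h
          have h0 : 0 ≤ Y i ω := le_min h.le hT.le
          simpa [sq] using mul_le_mul_of_nonneg_left (min_le_right (σ i ω) T) h0
      _ = _ := by simp [mul_assoc]
  have hmean : P[∑ i ∈ Finset.range k, Y i] = k * m := by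
    simp only [Finset.sum_apply]
    rw [integral_finsetSum _ fun i _ => (hY i).integrable (by norm_num)]
    simp [Y, hm]
  have hcheb := meas_ge_le_variance_div_sq (memLp_finsetSum' (Finset.range k) fun i _ => hY i) hc
  rw [hmean] at hcheb
  have h2 := ENNReal.toReal_mono ENNReal.ofReal_ne_top hcheb
  rw [ENNReal.toReal_ofReal (div_nonneg (variance_nonneg _ _) (sq_nonneg c))] at h2
  simp only [Finset.sum_apply] at h2
  exact h2.trans (by gcongr)

/-- The number of marked excursions among the first `k`, none of which exceeds `T`, has binomial
weights. -/
theorem prob_marks_eq {Ω : Type*} [MeasurableSpace Ω] {P : Measure Ω}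
    [IsProbabilityMeasure P] {σ : ℕ → Ω → ℝ} (hσ : ∀ n, Measurable (σ n)) (hind : iIndepFun σ P)
    {T p q : ℝ} {H : Set ℝ} (hH : MeasurableSet H) (hHT : H ⊆ Iic T)
    (hp : ∀ n, P.real (σ n ⁻¹' H) = p) (hq : ∀ n, P.real {ω | T < σ n ω} = q) (k n : ℕ) :
    P.real {ω | (∀ i < k, σ i ω ≤ T) ∧ {i | i < k ∧ σ i ω ∈ H}.encard = (n : ℕ∞)} =
      k.choose n * p ^ n * (1 - (p + q)) ^ (k - n) := by
  -- For each prescribed set `F` of marked indices the event is a product event; the event in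
  -- question is the disjoint union of these over all `F` with `n` elements.
  set D : Finset ℕ → ℕ → Set ℝ := fun F i => if i ∈ F then H else Iic T \ H
  have hD : ∀ F i, MeasurableSet (D F i) := fun F i => by
    simp only [D]; split_ifs
    · exact hH
    · exact measurableSet_Iic.diff hH
  have hcompl : ∀ i, P.real (σ i ⁻¹' (Iic T \ H)) = 1 - (p + q) := fun i => by
    have h1 : σ i ⁻¹' (Iic T \ H) = (σ i ⁻¹' (H ∪ Ioi T))ᶜ := by
      rw [← preimage_compl, compl_union, compl_Ioi, inter_comm, sdiff_eq]
    rw [h1, probReal_compl_eq_one_sub (hσ i (hH.union measurableSet_Ioi)), preimage_union,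
      measureReal_union _ (hσ i measurableSet_Ioi), hp i]
    · rw [show σ i ⁻¹' Ioi T = {ω | T < σ i ω} from rfl, hq i]
    · exact Disjoint.preimage _ (disjoint_left.2 fun u h1 h2 => absurd (mem_Iic.1 (hHT h1)) (not_le.2 (mem_Ioi.1 h2)))
  have hset : {ω | (∀ i < k, σ i ω ≤ T) ∧ {i | i < k ∧ σ i ω ∈ H}.encard = (n : ℕ∞)} =
      ⋃ F ∈ Finset.powersetCard n (Finset.range k),
        ⋂ i ∈ Finset.range k, σ i ⁻¹' D F i := by
    classical
    ext ω
    simp only [mem_ofPred_eq, mem_iUnion, mem_iInter, Finset.mem_powersetCard, mem_preimage,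
      Finset.mem_range, exists_prop]
    have hfin : {i | i < k ∧ σ i ω ∈ H} =
        (((Finset.range k).filter fun i => σ i ω ∈ H : Finset ℕ) : Set ℕ) := by
      ext i; simp
    constructor
    · rintro ⟨h1, h2⟩
      rw [hfin, Set.encard_coe_eq_coe_finsetCard] at h2
      refine ⟨_, ⟨Finset.filter_subset _ _, by exact_mod_cast h2⟩, fun i hi => ?_⟩
      by_cases hiH : σ i ω ∈ H
      · simp [D, hi, hiH]
      · simp [D, hiH, h1 i hi]
    · rintro ⟨F, ⟨hF, hcard⟩, h⟩
      refine ⟨fun i hi => ?_, ?_⟩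
      · have := h i hi
        simp only [D] at this
        split_ifs at this
        · exact hHT this
        · exact this.1
      · have : {i | i < k ∧ σ i ω ∈ H} = (F : Set ℕ) := by
          ext i
          simp only [mem_ofPred_eq, Finset.mem_coe]
          constructor
          · rintro ⟨hi, hiH⟩
            by_contra hc
            have := h i hi
            simp only [D, hc, if_false] at this
            exact this.2 hiH
          · intro hi
            have hik := Finset.mem_range.1 (hF hi)
            have := h i hik
            simp only [D, hi, if_true] at this
            exact ⟨hik, this⟩
        rw [this, Set.encard_coe_eq_coe_finsetCard, hcard]
  rw [hset, measureReal_biUnion_finset]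
  · have : ∀ F ∈ Finset.powersetCard n (Finset.range k),
        P.real (⋂ i ∈ Finset.range k, σ i ⁻¹' D F i) = p ^ n * (1 - (p + q)) ^ (k - n) := by
      intro F hF
      rw [Finset.mem_powersetCard] at hF
      rw [measureReal_def, hind.measure_inter_preimage_eq_mul _ fun i _ => hD F i,
        ENNReal.toReal_prod]
      have : ∀ i ∈ Finset.range k, (P (σ i ⁻¹' D F i)).toReal =
          if i ∈ F then p else 1 - (p + q) := fun i _ => by
        simp only [D]; split_ifs
        · exact hp i
        · exact hcompl i
      rw [Finset.prod_congr rfl this, Finset.prod_ite, Finset.prod_const, Finset.prod_const,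
        Finset.filter_mem_eq_inter, Finset.inter_eq_right.2 hF.1, hF.2, Finset.filter_notMem_eq_sdiff,
        Finset.card_sdiff_of_subset hF.1, hF.2, Finset.card_range]
    rw [Finset.sum_congr rfl this, Finset.sum_const, Finset.card_powersetCard, Finset.card_range,
      nsmul_eq_mul, mul_assoc]
  · intro F hF G hG hFG
    refine disjoint_left.2 fun ω h1 h2 => hFG ?_
    simp only [mem_iInter, mem_preimage] at h1 h2
    have hF' := (Finset.mem_powersetCard.1 hF).1
    have hG' := (Finset.mem_powersetCard.1 hG).1
    ext i
    constructor
    · intro hi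
      have a1 := h1 i (hF' hi)
      have a2 := h2 i (hF' hi)
      by_contra hc
      simp only [D, hi, hc, if_true, if_false] at a1 a2
      exact a2.2 a1
    · intro hi
      have a1 := h1 i (hG' hi)
      have a2 := h2 i (hG' hi)
      by_contra hc
      simp only [D, hi, hc, if_true, if_false] at a1 a2
      exact a1.2 a2
  · exact fun F _ => Finset.measurableSet_biInter _ fun i _ => hσ i (hD F i)

theorem prob_exists_mark_le {Ω : Type*} [MeasurableSpace Ω] {P : Measure Ω}
    [IsProbabilityMeasure P] {σ : ℕ → Ω → ℝ} {T p q : ℝ} {H : Set ℝ}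
    (hp : ∀ n, P.real (σ n ⁻¹' H) = p) (hq : ∀ n, P.real {ω | T < σ n ω} = q) (m k : ℕ) :
    P.real {ω | ∃ i, m ≤ i ∧ i < k ∧ (T < σ i ω ∨ σ i ω ∈ H)} ≤ (k - m : ℕ) * (p + q) := by
  have : {ω | ∃ i, m ≤ i ∧ i < k ∧ (T < σ i ω ∨ σ i ω ∈ H)} =
      ⋃ i ∈ Finset.Ico m k, (σ i ⁻¹' H ∪ {ω | T < σ i ω}) := by
    ext ω
    simp only [mem_ofPred_eq, mem_iUnion, Finset.mem_Ico, mem_union, mem_preimage, exists_prop,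
      and_assoc, or_comm]
  rw [this]
  refine (measureReal_biUnion_finset_le _ _).trans ?_
  calc _ ≤ ∑ i ∈ Finset.Ico m k, (p + q) := Finset.sum_le_sum fun i _ =>
        (measureReal_union_le _ _).trans (by rw [hp, hq])
    _ = _ := by rw [Finset.sum_const, Nat.card_Ico, nsmul_eq_mul]

/-- Comparison of the law of the spike count up to time `r` with the binomial law of the marks of
a deterministic number of excursions. -/
theorem abs_prob_sub_le {Ω : Type*} [MeasurableSpace Ω] {P : Measure Ω}
    [IsProbabilityMeasure P] {σ : ℕ → Ω → ℝ} (hσ : ∀ n, Measurable (σ n)) (hind : iIndepFun σ P)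
    (hpos : ∀ n, ∀ᵐ ω ∂P, 0 < σ n ω) {x : ℝ → ℝ} (hx : ContinuousOn x (Ici 0)) {y T m p q : ℝ}
    (hxT : IsHit x y T) (hm0 : 0 < m) (hm : ∀ n, ∫ ω, min (σ n ω) T ∂P = m)
    {A H : Set ℝ} (hH : MeasurableSet H) (hHT : H ⊆ Iic T)
    (hAH : ∀ᵐ ω ∂P, ∀ n, σ n ω ≤ T → (x (σ n ω) ∈ A ↔ σ n ω ∈ H))
    (hp : ∀ n, P.real (σ n ⁻¹' H) = p) (hq : ∀ n, P.real {ω | T < σ n ω} = q)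
    {r δ : ℝ} (hr : 0 ≤ r) (hδ : T < δ) {I : Set ℝ} (hI : Ioo 0 r ⊆ I) (hI' : I ⊆ Ioc 0 r)
    (n : ℕ) :
    |P.real {ω | (r : EReal) ≤ firstJump x y (fun k => σ k ω) ∧
        preSpikeCount x (fun k => σ k ω) I A = (n : ℕ∞)} -
      (⌊(r - δ) / m⌋₊.choose n * p ^ n * (1 - (p + q)) ^ (⌊(r - δ) / m⌋₊ - n))| ≤
      r * T / (δ - T) ^ 2 + (r + δ + m) * T / δ ^ 2 + (2 * δ / m + 2) * (p + q) := by
  set k := ⌊(r - δ) / m⌋₊ with hk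
  set l := ⌈(r + δ) / m⌉₊ with hl
  have hT := hxT.pos
  have hδ0 : 0 < δ := hT.trans hδ
  have hp0 : 0 ≤ p := by rw [← hp 0]; positivity
  have hq0 : 0 ≤ q := by rw [← hq 0]; positivity
  set J := {ω | (r : EReal) ≤ firstJump x y (fun k => σ k ω) ∧
        preSpikeCount x (fun k => σ k ω) I A = (n : ℕ∞)}
  set E := {ω | (∀ i < k, σ i ω ≤ T) ∧ {i | i < k ∧ σ i ω ∈ H}.encard = (n : ℕ∞)} with hE
  -- The bad events: the first `k` excursions last too long, the first `l` are too short, or some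
  -- excursion between `k` and `l` is marked or overshoots. The guard `k ≠ 0` matters when `r` is
  -- small, since `r - T` may then be negative.
  set B₁ := {ω | k ≠ 0 ∧ r - T ≤ ∑ i ∈ Finset.range k, min (σ i ω) T}
  set B₂ := {ω | ∑ i ∈ Finset.range l, min (σ i ω) T ≤ r}
  set B₃ := {ω | ∃ i, k ≤ i ∧ i < l ∧ (T < σ i ω ∨ σ i ω ∈ H)}
  have h1 : P.real B₁ ≤ r * T / (δ - T) ^ 2 := by
    by_cases hk0 : k = 0
    · simp only [B₁, hk0, ne_eq, not_true, false_and]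
      have : (0 : ℝ) ≤ r * T / (δ - T) ^ 2 := by positivity
      simpa using this
    · have hkm : k * m ≤ r - δ := by
        have : 0 < (r - δ) / m := by
          by_contra! hc
          exact hk0 (Nat.floor_of_nonpos hc)
        have := Nat.floor_le this.le
        rwa [le_div_iff₀ hm0] at this
      refine (measureReal_mono (s₂ := {ω | δ - T ≤ |∑ i ∈ Finset.range k, min (σ i ω) T - k * m|})
        fun ω hω => ?_).trans
        ((prob_deviation_le hσ hind hpos hT hm k (sub_pos.2 hδ)).trans ?_)
      · have := hω.2
        have h4 := le_abs_self (∑ i ∈ Finset.range k, min (σ i ω) T - k * m)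
        rw [mem_ofPred_eq]
        linarith
      · gcongr
        linarith
  have h2 : P.real B₂ ≤ (r + δ + m) * T / δ ^ 2 := by
    have hlm : r + δ ≤ l * m := by
      rw [← div_le_iff₀ hm0]; exact Nat.le_ceil _
    have hlm' : l * m ≤ r + δ + m := by
      have := (Nat.ceil_lt_add_one (show 0 ≤ (r + δ) / m by positivity)).le
      calc l * m ≤ ((r + δ) / m + 1) * m := by gcongr
        _ = _ := by field_simp
    refine (measureReal_mono (s₂ := {ω | δ ≤ |∑ i ∈ Finset.range l, min (σ i ω) T - l * m|})
        fun ω hω => ?_).trans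
        ((prob_deviation_le hσ hind hpos hT hm l hδ0).trans ?_)
    · have : ∑ i ∈ Finset.range l, min (σ i ω) T ≤ r := hω
      have h4 := neg_le_abs (∑ i ∈ Finset.range l, min (σ i ω) T - l * m)
      rw [mem_ofPred_eq]
      linarith
    · gcongr
  have h3 : P.real B₃ ≤ (2 * δ / m + 2) * (p + q) := by
    refine (prob_exists_mark_le hp hq k l).trans ?_
    gcongr
    have hkl : k ≤ l := (Nat.floor_mono (by gcongr; linarith)).trans (Nat.floor_le_ceil _)
    rw [Nat.cast_sub hkl]
    have a1 := Nat.ceil_lt_add_one (show 0 ≤ (r + δ) / m by positivity)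
    have a2 := Nat.lt_floor_add_one ((r - δ) / m)
    rw [← hl] at a1
    rw [← hk] at a2
    have a3 : 2 * δ / m = (r + δ) / m - (r - δ) / m := by ring
    linarith
  have hiff : ∀ᵐ ω ∂P, ω ∉ B₁ ∪ B₂ ∪ B₃ → (ω ∈ J ↔ ω ∈ E) := by
    filter_upwards [hAH, ae_all_iff.2 hpos] with ω hω1 hω2 hB
    simp only [B₁, B₂, B₃, mem_union, mem_ofPred_eq, not_or, not_and, not_le, not_exists, not_lt]
      at hB
    refine noJump_and_count_iff hx hxT hω2 hI hI' hω1 (m := k) (k := l) ?_ hB.1.2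
      (fun i hi hil => hB.2 i hi hil) n
    by_cases hk0 : k = 0
    · exact Or.inl hk0
    · exact Or.inr (hB.1.1 hk0)
  have hB : P.real (B₁ ∪ B₂ ∪ B₃) ≤
      r * T / (δ - T) ^ 2 + (r + δ + m) * T / δ ^ 2 + (2 * δ / m + 2) * (p + q) :=
    (measureReal_union_le _ _).trans (add_le_add ((measureReal_union_le _ _).trans
      (add_le_add h1 h2)) h3)
  -- Only monotonicity and subadditivity enter, so the events need not be measurable here.
  have hcomp : ∀ U V : Set Ω, (∀ᵐ ω ∂P, ω ∉ B₁ ∪ B₂ ∪ B₃ → ω ∈ U → ω ∈ V) →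
      P.real U ≤ P.real V + P.real (B₁ ∪ B₂ ∪ B₃) := fun U V h => by
    refine le_trans ?_ (measureReal_union_le _ _)
    refine ENNReal.toReal_mono (measure_ne_top _ _) (measure_mono_ae ?_)
    filter_upwards [h] with ω hω hU
    by_cases hb : ω ∈ B₁ ∪ B₂ ∪ B₃
    · exact Or.inr hb
    · exact Or.inl (hω hb hU)
  rw [← prob_marks_eq hσ hind hH hHT hp hq, ← hE, abs_le]
  have c1 := hcomp J E (hiff.mono fun ω h hb => (h hb).1)
  have c2 := hcomp E J (hiff.mono fun ω h hb => (h hb).2)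
  constructor <;> linarith

end Estimates

/-! ### Poisson limit of binomial weights. -/

section PoissonLimit

/-- Writing `M - k` as `M - min M k` makes the correction at most `k |p|`. Nothing forces `M → ∞`,
which is what allows limiting times `ρ = 0`. -/
theorem tendsto_natSub_mul {ι : Type*} {l : Filter ι} {M : ι → ℕ} {p : ι → ℝ} {A : ℝ}
    (hM : Tendsto (fun i => M i * p i) l (𝓝 A)) (hp : Tendsto p l (𝓝 0)) (k : ℕ) :
    Tendsto (fun i => ((M i - k : ℕ) : ℝ) * p i) l (𝓝 A) := by
  have h0 : Tendsto (fun i => ((min (M i) k : ℕ) : ℝ) * p i) l (𝓝 0) := by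
    refine squeeze_zero_norm (a := fun i => k * |p i|) (fun i => ?_) ?_
    · rw [norm_mul, Real.norm_eq_abs (p i), Real.norm_of_nonneg (Nat.cast_nonneg _)]
      gcongr
      exact min_le_right _ _
    · simpa using hp.abs.const_mul (k : ℝ)
  have h1 := hM.sub h0
  rw [sub_zero] at h1
  refine h1.congr fun i => ?_
  have : ((M i - k : ℕ) : ℝ) + ((min (M i) k : ℕ) : ℝ) = M i := by
    rw [← Nat.cast_add]; congr 1; omega
  rw [← this]; ring

theorem tendsto_choose_mul_pow {ι : Type*} {l : Filter ι} {M : ι → ℕ} {p : ι → ℝ} {A : ℝ}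
    (hM : Tendsto (fun i => M i * p i) l (𝓝 A)) (hp : Tendsto p l (𝓝 0)) (n : ℕ) :
    Tendsto (fun i => (M i).choose n * p i ^ n) l (𝓝 (A ^ n / n.factorial)) := by
  have h1 : Tendsto (fun i => ((M i).descFactorial n : ℝ) * p i ^ n) l (𝓝 (A ^ n)) := by
    induction n with
    | zero => simp [tendsto_const_nhds]
    | succ n ih =>
      rw [pow_succ']
      refine ((tendsto_natSub_mul hM hp n).mul ih).congr fun i => ?_
      rw [Nat.descFactorial_succ]; push_cast; ring
  refine (h1.div_const (n.factorial : ℝ)).congr fun i => ?_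
  rw [Nat.descFactorial_eq_factorial_mul_choose]
  have : (n.factorial : ℝ) ≠ 0 := by positivity
  push_cast
  field_simp

/-- The logarithm is squeezed by `-v / (1 - v) ≤ log (1 - v) ≤ -v`. -/
theorem tendsto_one_sub_pow {ι : Type*} {l : Filter ι} {M : ι → ℕ} {v : ι → ℝ} {B : ℝ}
    (hM : Tendsto (fun i => M i * v i) l (𝓝 B)) (hv : Tendsto v l (𝓝 0)) :
    Tendsto (fun i => (1 - v i) ^ M i) l (𝓝 (Real.exp (-B))) := by
  have hlt := hv.eventually_lt_const (show (0 : ℝ) < 1 by norm_num)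
  have hlog : Tendsto (fun i => M i * Real.log (1 - v i)) l (𝓝 (-B)) := by
    have hlow : Tendsto (fun i => -(M i * v i / (1 - v i))) l (𝓝 (-B)) := by
      have := (hM.div (hv.const_sub 1) (by norm_num)).neg
      simpa using this
    refine tendsto_of_tendsto_of_tendsto_of_le_of_le' hlow hM.neg ?_ ?_
    · filter_upwards [hlt] with i hi
      have h1 : 0 < 1 - v i := by linarith
      have h := mul_le_mul_of_nonneg_left (Real.one_sub_inv_le_log_of_pos h1) (M i).cast_nonneg
      refine le_trans (le_of_eq ?_) h
      field_simp
      ring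
    · filter_upwards [hlt] with i hi
      have h1 : 0 < 1 - v i := by linarith
      have h := mul_le_mul_of_nonneg_left (Real.log_le_sub_one_of_pos h1) (M i).cast_nonneg
      linarith
  refine ((Real.continuous_exp.tendsto _).comp hlog).congr' ?_
  filter_upwards [hlt] with i hi
  rw [Function.comp_apply, mul_comm, ← Real.rpow_def_of_pos (by linarith), Real.rpow_natCast]

/-- Poisson limit of binomial weights along an arbitrary filter. -/
theorem tendsto_binomial {ι : Type*} {l : Filter ι} {M : ι → ℕ} {p v : ι → ℝ} {A B : ℝ}
    (hMp : Tendsto (fun i => M i * p i) l (𝓝 A)) (hp : Tendsto p l (𝓝 0))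
    (hMv : Tendsto (fun i => M i * v i) l (𝓝 B)) (hv : Tendsto v l (𝓝 0)) (n : ℕ) :
    Tendsto (fun i => (M i).choose n * p i ^ n * (1 - v i) ^ (M i - n)) l
      (𝓝 (A ^ n / n.factorial * Real.exp (-B))) :=
  (tendsto_choose_mul_pow hMp hp n).mul (tendsto_one_sub_pow (tendsto_natSub_mul hMv hv n) hv)

end PoissonLimit

/-! ### Law of a single waiting time. -/

section WaitingTimes

theorem IsWaitingTimes.prob_gt {Ω : Type*} [MeasurableSpace Ω] {P : Measure Ω}
    [IsProbabilityMeasure P] {h : ℝ → ℝ} {ε : ℝ} {x : ℝ → ℝ} {σ : ℕ → Ω → ℝ}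
    (hσ : IsWaitingTimes P h ε x σ) (n : ℕ) {t : ℝ} (ht : 0 ≤ t) :
    P.real {ω | t < σ n ω} = survival h ε x t := by
  rcases ht.lt_or_eq with h | rfl
  · exact hσ.tail n t h
  · rw [survival_zero, measureReal_congr (eventuallyEq_univ.2 (hσ.pos n)), probReal_univ]

theorem IsWaitingTimes.prob_Ioc {Ω : Type*} [MeasurableSpace Ω] {P : Measure Ω}
    [IsProbabilityMeasure P] {h : ℝ → ℝ} {ε : ℝ} {x : ℝ → ℝ} {σ : ℕ → Ω → ℝ}
    (hσ : IsWaitingTimes P h ε x σ) (n : ℕ) {s t : ℝ} (hs : 0 ≤ s) (hst : s ≤ t) :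
    P.real (σ n ⁻¹' Ioc s t) = survival h ε x s - survival h ε x t := by
  rw [← hσ.prob_gt n hs, ← hσ.prob_gt n (hs.trans hst), ← Ioi_sdiff_Ioi, preimage_sdiff,
    measureReal_sdiff (preimage_mono (Ioi_subset_Ioi hst)) (hσ.measurable n measurableSet_Ioi)]
  rfl

/-- The tail is continuous, so there are no atoms; this lets closed level windows be replaced by
half-open time windows. -/
theorem IsWaitingTimes.ae_ne {Ω : Type*} [MeasurableSpace Ω] {P : Measure Ω}
    [IsProbabilityMeasure P] {f h : ℝ → ℝ} (hfh : Coefficients f h) {ε : ℝ} {x : ℝ → ℝ}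
    (hx : IsFlow f h ε x) {σ : ℕ → Ω → ℝ}
    (hσ : IsWaitingTimes P h ε x σ) (n : ℕ) {t : ℝ} (ht : 0 ≤ t) : ∀ᵐ ω ∂P, σ n ω ≠ t := by
  rcases ht.lt_or_eq with h0 | rfl
  · have hlim : Tendsto (fun s => survival h ε x s - survival h ε x t) (𝓝[<] t) (𝓝 0) := by
      have := ((hx.hasDerivAt_survival hfh h0).continuousAt.tendsto.sub_const
        (survival h ε x t)).mono_left (nhdsWithin_le_nhds (s := Iio t))
      simpa using this
    have hle : P.real {ω | σ n ω = t} ≤ 0 := by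
      refine ge_of_tendsto hlim ?_
      filter_upwards [Ioo_mem_nhdsLT h0] with s hs
      rw [← hσ.prob_Ioc n hs.1.le hs.2.le]
      refine measureReal_mono fun ω hω => ?_
      rw [mem_ofPred_eq] at hω
      rw [mem_preimage, hω]
      exact ⟨hs.2, le_rfl⟩
    have h1 : P {ω | σ n ω = t} = 0 := by
      have := le_antisymm hle measureReal_nonneg
      rwa [measureReal_eq_zero_iff] at this
    rw [ae_iff]
    simpa using h1
  · filter_upwards [hσ.pos n] with ω h using h.ne'

/-- Layer-cake formula: the tail of `min σ T` is that of `σ` before `T` and vanishes from `T` on. -/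
theorem IsWaitingTimes.integral_min {Ω : Type*} [MeasurableSpace Ω] {P : Measure Ω}
    [IsProbabilityMeasure P] {h : ℝ → ℝ} {ε : ℝ} {x : ℝ → ℝ} {σ : ℕ → Ω → ℝ}
    (hσ : IsWaitingTimes P h ε x σ) (n : ℕ) {T : ℝ} (hT : 0 < T) :
    ∫ ω, min (σ n ω) T ∂P = ∫ s in (0 : ℝ)..T, survival h ε x s := by
  have hint := (memLp_min_const (hσ.measurable n) (hσ.pos n) hT).integrable (by norm_num)
  rw [hint.integral_eq_integral_meas_lt (by
    filter_upwards [hσ.pos n] with ω h using le_min h.le hT.le),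
    intervalIntegral.integral_of_le hT.le, integral_Ioc_eq_integral_Ioo,
    setIntegral_eq_of_subset_of_forall_sdiff_eq_zero measurableSet_Ioi Ioo_subset_Ioi_self]
  · refine setIntegral_congr_fun measurableSet_Ioo fun t ht => ?_
    rw [← hσ.prob_gt n ht.1.le]
    congr 1
    ext ω
    simp [ht.2]
  · intro t ht
    have hTt : T ≤ t := by
      by_contra! hc
      exact ht.2 ⟨ht.1, hc⟩
    have : {ω | t < min (σ n ω) T} = ∅ := by
      ext ω
      simp [hTt]
    rw [this, measureReal_empty]

end WaitingTimes

/-! ### Marks as time windows, and the conditional law as a probability measure. -/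

theorem mem_Icc_iff_mem_Ioc {f h : ℝ → ℝ} {ε : ℝ} {x : ℝ → ℝ} (hx : IsFlow f h ε x) {y T : ℝ}
    (hy : 0 ≤ y) (hTy : T = hitTime x y) (hxT : IsHit x y T) {a b : ℝ} (ha : 0 ≤ a) (hb : 0 ≤ b)
    {s : ℝ} (hs : 0 < s) (hsT : s ≤ T) (hsa : s ≠ hitTime x (min a y)) :
    x s ∈ Icc a b ↔ s ∈ Ioc (hitTime x (min a y)) (hitTime x (min b y)) := by
  have hle : ∀ c, min c y ≤ x T := fun c => hxT.map_eq ▸ min_le_right _ _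
  have hθ : ∀ c, hitTime x (min c y) ∈ Icc 0 T := fun c =>
    ⟨hitTime_nonneg _ _, hitTime_le hxT.pos.le (hle c)⟩
  have hmap : ∀ c, 0 ≤ c → x (hitTime x (min c y)) = min c y := fun c hc =>
    hx.map_hitTime (le_min hc hy) hxT.pos.le (hle c)
  have hsm : s ∈ Icc 0 T := ⟨hs.le, hsT⟩
  have hxs : x s ≤ y := by
    rw [← hxT.map_eq]
    exact hxT.strictMonoOn.monotoneOn hsm (right_mem_Icc.2 hxT.pos.le) hsT
  refine and_congr ⟨fun h => ?_, fun h => ?_⟩ ?_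
  · exact lt_of_le_of_ne (hitTime_le hs.le ((min_le_left _ _).trans h)) hsa.symm
  · rcases le_total a y with h1 | h1
    · have := hxT.strictMonoOn (hθ a) hsm h
      rw [hmap a ha, min_eq_left h1] at this
      exact this.le
    · rw [min_eq_right h1, ← hTy] at h
      exact absurd hsT (not_le.2 h)
  · rw [← hxT.strictMonoOn.le_iff_le hsm (hθ b), hmap b hb, le_min_iff, and_iff_left hxs]

/-- There are countably many finite sets of indices, and fixing the index set exactly is a countable
intersection. -/
theorem measurableSet_encard_eq {Ω : Type*} [MeasurableSpace Ω] {B : ℕ → Set Ω}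
    (hB : ∀ i, MeasurableSet (B i)) (n : ℕ) :
    MeasurableSet {ω | {i | ω ∈ B i}.encard = (n : ℕ∞)} := by
  have : {ω | {i | ω ∈ B i}.encard = (n : ℕ∞)} =
      ⋃ F ∈ {F : Finset ℕ | F.card = n}, ⋂ i, {ω | ω ∈ B i ↔ i ∈ F} := by
    ext ω
    simp only [mem_ofPred_eq, mem_iUnion, mem_iInter, exists_prop]
    constructor
    · intro h
      have hfin : {i | ω ∈ B i}.Finite := by
        rw [← encard_lt_top_iff, h]; exact ENat.natCast_lt_top n
      refine ⟨hfin.toFinset, ?_, fun i => by simp⟩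
      rw [hfin.encard_eq_coe_toFinset_card] at h
      exact_mod_cast h
    · rintro ⟨F, hF, h⟩
      have : {i | ω ∈ B i} = (F : Set ℕ) := by ext i; simpa using h i
      rw [this, encard_coe_eq_coe_finsetCard, hF]
  rw [this]
  refine MeasurableSet.biUnion (to_countable _) fun F _ => MeasurableSet.iInter fun i => ?_
  by_cases hi : i ∈ F
  · simp only [hi, iff_true]
    exact hB i
  · simp only [hi, iff_false]
    exact (hB i).compl

theorem measurable_resetTime {Ω : Type*} [MeasurableSpace Ω] {σ : ℕ → Ω → ℝ}
    (hσ : ∀ n, Measurable (σ n)) (n : ℕ) : Measurable fun ω => resetTime (fun k => σ k ω) n :=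
  Finset.measurable_sum _ fun i _ => hσ i

/-- The reset times almost surely diverge. -/
theorem IsWaitingTimes.ae_exists_lt_resetTime {Ω : Type*} [MeasurableSpace Ω] {P : Measure Ω}
    [IsProbabilityMeasure P] {h : ℝ → ℝ} {ε : ℝ} {x : ℝ → ℝ} {σ : ℕ → Ω → ℝ}
    (hσ : IsWaitingTimes P h ε x σ) {T : ℝ} (hT : 0 < T)
    (hm : 0 < ∫ s in (0 : ℝ)..T, survival h ε x s) :
    ∀ᵐ ω ∂P, ∀ r : ℝ, ∃ k, r < resetTime (fun k => σ k ω) k := by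
  set m := ∫ s in (0 : ℝ)..T, survival h ε x s
  have key : ∀ K : ℕ, ∀ᵐ ω ∂P, ∃ k, (K : ℝ) < resetTime (fun k => σ k ω) k := fun K => by
    -- This is Chebyshev's bound for a deviation of half the mean, `k m / 2`, with `k` so large that
    -- `k m / 2 ≥ K`.
    have hlim : Tendsto (fun k : ℕ => 4 * T / m / k) atTop (𝓝 0) :=
      tendsto_const_div_atTop_nhds_zero_nat _
    have hle : P.real {ω | ¬∃ k, (K : ℝ) < resetTime (fun k => σ k ω) k} ≤ 0 := by
      refine ge_of_tendsto hlim ?_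
      filter_upwards [eventually_ge_atTop (⌈2 * K / m⌉₊ + 1)] with k hk
      have hk0 : (0 : ℝ) < k := by exact_mod_cast (show 0 < k by omega)
      have hkm : 2 * K ≤ k * m := by
        rw [← div_le_iff₀ hm]
        exact (Nat.le_ceil _).trans (Nat.cast_le.2 (by omega))
      have hc := prob_deviation_le hσ.measurable hσ.indep hσ.pos hT
        (fun n => hσ.integral_min n hT) k (c := k * m / 2) (by positivity)
      refine le_trans (measureReal_mono fun ω hω => ?_) (hc.trans_eq ?_)
      · simp only [mem_ofPred_eq, not_exists, not_lt] at hω ⊢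
        have h1 : ∑ i ∈ Finset.range k, min (σ i ω) T ≤ K :=
          (Finset.sum_le_sum fun i _ => min_le_left _ _).trans (hω k)
        have h2 := neg_le_abs (∑ i ∈ Finset.range k, min (σ i ω) T - k * m)
        linarith
      · change k * m * T / (k * m / 2) ^ 2 = _
        field_simp
        norm_num
    have := le_antisymm hle measureReal_nonneg
    rwa [measureReal_eq_zero_iff] at this
  filter_upwards [ae_all_iff.2 key] with ω hω r
  obtain ⟨K, hK⟩ := exists_nat_gt r
  obtain ⟨k, hk⟩ := hω K
  exact ⟨k, hK.trans hk⟩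

/-- Almost surely only finitely many resets occur before `t`, so the finite counts exhaust the
no-jump event; null-measurability then permits countable additivity. -/
theorem isProbabilityMeasure_condLaw {Ω : Type*} [MeasurableSpace Ω] {P : Measure Ω}
    [IsProbabilityMeasure P] {f h : ℝ → ℝ} {β ε : ℝ} {x : ℝ → ℝ}
    (hx : IsFlow f h ε x) {σ : ℕ → Ω → ℝ} (hσ : IsWaitingTimes P h ε x σ) {T : ℝ}
    (hxT : IsHit x (1 - ε ^ β) T) (hm : 0 < ∫ s in (0 : ℝ)..T, survival h ε x s) {t a b : ℝ}
    (hN : 0 < P.real (noJump β ε x σ t)) :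
    IsProbabilityMeasure (condLaw P β ε x σ t a b) := by
  have hgood : ∀ᵐ ω ∂P, (∀ n, 0 < σ n ω) ∧ ∀ r : ℝ, ∃ k, r < resetTime (fun k => σ k ω) k :=
    (ae_all_iff.2 hσ.pos).and (hσ.ae_exists_lt_resetTime hxT.pos hm)
  have hxc : Continuous fun s => x (max s 0) :=
    hx.continuousOn.comp_continuous (by fun_prop) fun s => le_max_right s 0
  have hτ := measurable_resetTime hσ.measurable
  have hNm : NullMeasurableSet (noJump β ε x σ t) P := by
    have hms : MeasurableSet {ω | ∀ i, resetTime (fun k => σ k ω) i < t →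
        σ i ω ≤ T ∨ t ≤ resetTime (fun k => σ k ω) i + T} := by
      have e : {ω | ∀ i, resetTime (fun k => σ k ω) i < t →
        σ i ω ≤ T ∨ t ≤ resetTime (fun k => σ k ω) i + T} =
        ⋂ i, ({ω | resetTime (fun k => σ k ω) i < t}ᶜ ∪
          ({ω | σ i ω ≤ T} ∪ {ω | t ≤ resetTime (fun k => σ k ω) i + T})) := by
        ext ω
        simp only [mem_ofPred_eq, mem_iInter, mem_union, mem_compl_iff, imp_iff_not_or]
      rw [e]
      exact MeasurableSet.iInter fun i => (measurableSet_lt (hτ i) measurable_const).compl.union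
        ((measurableSet_le (hσ.measurable i) measurable_const).union
          (measurableSet_le measurable_const ((hτ i).add_const T)))
    refine hms.nullMeasurableSet.congr (eventuallyEq_set.2 ?_)
    filter_upwards [hgood] with ω hω
    obtain ⟨k, hk⟩ := hω.2 t
    exact (le_firstJump_iff hxT hω.1 hk.le).symm
  have hCm : ∀ n, NullMeasurableSet (countEq x σ (Ioo 0 t) (Icc a b) n) P := fun n => by
    have hms := measurableSet_encard_eq (B := fun i => {ω | resetTime (fun k => σ k ω) (i + 1) ∈
      Ioo 0 t ∧ x (max (σ i ω) 0) ∈ Icc a b}) (fun i => ((hτ (i + 1)) measurableSet_Ioo).inter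
        ((hxc.measurable.comp (hσ.measurable i)) measurableSet_Icc)) n
    refine hms.nullMeasurableSet.congr (eventuallyEq_set.2 ?_)
    filter_upwards [hgood] with ω hω
    have : ∀ i, max (σ i ω) 0 = σ i ω := fun i => max_eq_left (hω.1 i).le
    simp only [countEq, mem_ofPred_eq, preSpikeCount_eq hx.continuousOn hω.1, this]
  have hsum : P (noJump β ε x σ t) =
      ∑' n, P (countEq x σ (Ioo 0 t) (Icc a b) n ∩ noJump β ε x σ t) := by
    rw [← measure_iUnion₀ (fun i j hij => Disjoint.aedisjoint ?_)
      fun n => (hCm n).inter hNm]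
    · refine measure_congr (eventuallyEq_set.2 ?_)
      filter_upwards [hgood] with ω hω
      simp only [mem_iUnion, mem_inter_iff, exists_and_right]
      refine ⟨fun h => ⟨?_, h⟩, fun h => h.2⟩
      obtain ⟨k, hk⟩ := hω.2 t
      have hfin : {i | resetTime (fun k => σ k ω) (i + 1) ∈ Ioo 0 t ∧
          x (σ i ω) ∈ Icc a b}.Finite := by
        refine (finite_Iio k).subset fun i hi => ?_
        have := (strictMono_resetTime hω.1).lt_iff_lt.1 (hi.1.2.trans hk)
        simp only [mem_Iio]
        omega
      refine ⟨hfin.toFinset.card, ?_⟩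
      simp only [countEq, mem_ofPred_eq]
      rw [preSpikeCount_eq hx.continuousOn hω.1, hfin.encard_eq_coe_toFinset_card]
    · refine disjoint_left.2 fun ω h1 h2 => hij ?_
      have h3 : ((i : ℕ) : ℕ∞) = j := h1.1.symm.trans h2.1
      exact_mod_cast h3
  constructor
  rw [condLaw, Measure.sum_apply _ MeasurableSet.univ]
  have hP0 : P (noJump β ε x σ t) ≠ 0 := by
    intro h0
    rw [measureReal_def, h0] at hN
    simp at hN
  have hterm : ∀ n, (ENNReal.ofReal (condProb P β ε x σ t a b n) • Measure.dirac n) univ =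
      P (countEq x σ (Ioo 0 t) (Icc a b) n ∩ noJump β ε x σ t) * (P (noJump β ε x σ t))⁻¹ :=
    fun n => by
      rw [Measure.smul_apply, measure_univ, smul_eq_mul, mul_one, condProb,
        ENNReal.ofReal_div_of_pos hN, ofReal_measureReal, ofReal_measureReal, div_eq_mul_inv]
  simp_rw [hterm]
  rw [ENNReal.tsum_mul_right, ← hsum, ENNReal.mul_inv_cancel hP0 (measure_ne_top _ _)]

theorem lamStar_Icc {f : ℝ → ℝ} (hf : 0 < f 0) {a b : ℝ} (ha : 0 < a) (hab : a ≤ b)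
    (hb : b ≤ 1) : lamStar f (Icc a b) = ENNReal.ofReal (f 0 * (1 / a - 1 / b)) := by
  rw [lamStar, withDensity_apply _ measurableSet_Icc, Measure.restrict_restrict measurableSet_Icc,
    inter_eq_left.2 (Icc_subset_Icc ha.le hb)]
  have hcont : ContinuousOn (fun u : ℝ => f 0 / u ^ 2) (Icc a b) :=
    continuousOn_const.div (by fun_prop) fun u hu => by
      have : 0 < u := ha.trans_le hu.1
      positivity
  rw [← ofReal_integral_eq_lintegral_ofReal hcont.integrableOn_Icc
    (ae_of_all _ fun u => by positivity)]
  congr 1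
  rw [integral_Icc_eq_integral_Ioc, ← intervalIntegral.integral_of_le hab]
  rw [intervalIntegral.integral_eq_sub_of_hasDerivAt (f := fun u => -(f 0 / u))]
  · ring
  · intro u hu
    rw [uIcc_of_le hab] at hu
    have hu0 : u ≠ 0 := (ha.trans_le hu.1).ne'
    convert! ((hasDerivAt_const u (f 0)).div (hasDerivAt_id u) hu0).neg using 1
    simp
    ring
  · refine ContinuousOn.intervalIntegrable ?_
    rwa [uIcc_of_le hab]

/-! ### Passage to the limit. -/

theorem tendsto_meanTime {f h : ℝ → ℝ} (hfh : Coefficients f h) {β : ℝ}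
    (hβ : β ∈ Ioo (0 : ℝ) (1 / 2)) {x : ℝ → ℝ → ℝ} (hx : ∀ ε : ℝ, 0 < ε → IsFlow f h ε (x ε)) :
    Tendsto (fun ε => meanTime h β ε (x ε)) (𝓝[>] 0) (𝓝 0) := by
  refine squeeze_zero' ?_ ?_ (tendsto_hitTime hfh hβ hx)
  · filter_upwards [self_mem_nhdsWithin, eventually_hit hfh hβ hx] with ε hε hh
    exact ((hx ε hε).meanTime_pos hfh hh.pos).le
  · filter_upwards [self_mem_nhdsWithin, eventually_hit hfh hβ hx] with ε hε hh
    exact (hx ε hε).meanTime_le hfh hε hh.pos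

theorem tendsto_survival_hitTime_div {f h : ℝ → ℝ} (hfh : Coefficients f h) {β : ℝ}
    (hβ : β ∈ Ioo (0 : ℝ) (1 / 2)) {x : ℝ → ℝ → ℝ} (hx : ∀ ε : ℝ, 0 < ε → IsFlow f h ε (x ε)) :
    Tendsto (fun ε => survival h ε (x ε) (hitTime (x ε) (1 - ε ^ β)) / meanTime h β ε (x ε))
      (𝓝[>] 0) (𝓝 (f 0)) := by
  have := tendsto_survival_div hfh hβ hx one_pos le_rfl
  rw [div_one] at this
  refine this.congr' ?_
  filter_upwards [self_mem_nhdsWithin] with ε (hε : 0 < ε)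
  rw [min_eq_right (by linarith [Real.rpow_pos_of_pos hε β])]

/-- Poisson limit for the number of spikes without a jump, along an arbitrary filter. -/
theorem tendsto_prob_noJump_count {f h : ℝ → ℝ} (hfh : Coefficients f h) {β : ℝ}
    (hβ : β ∈ Ioo (0 : ℝ) (1 / 2)) {x : ℝ → ℝ → ℝ} (hx : ∀ ε : ℝ, 0 < ε → IsFlow f h ε (x ε))
    {Ω : ℝ → Type*} [∀ ε, MeasurableSpace (Ω ε)]
    {P : ∀ ε, Measure (Ω ε)} [∀ ε, IsProbabilityMeasure (P ε)]
    {σ : ∀ ε, ℕ → Ω ε → ℝ}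
    (hσ : ∀ ε : ℝ, 0 < ε → IsWaitingTimes (P ε) h ε (x ε) (σ ε))
    {A : Set ℝ} {H : ℝ → Set ℝ} {p : ℝ → ℝ} {κ : ℝ}
    (hH : ∀ᶠ ε in 𝓝[>] (0 : ℝ), MeasurableSet (H ε) ∧ H ε ⊆ Iic (hitTime (x ε) (1 - ε ^ β)) ∧
      (∀ᵐ ω ∂P ε, ∀ n, σ ε n ω ≤ hitTime (x ε) (1 - ε ^ β) →
        (x ε (σ ε n ω) ∈ A ↔ σ ε n ω ∈ H ε)) ∧ ∀ n, (P ε).real (σ ε n ⁻¹' H ε) = p ε)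
    (hp : Tendsto (fun ε => p ε / meanTime h β ε (x ε)) (𝓝[>] 0) (𝓝 κ))
    {I : ℝ → Set ℝ} (hI : ∀ r, Ioo 0 r ⊆ I r) (hI' : ∀ r, I r ⊆ Ioc 0 r)
    {ι : Type*} {l : Filter ι} {e r : ι → ℝ} {ρ : ℝ} (he : Tendsto e l (𝓝[>] 0))
    (hr : Tendsto r l (𝓝 ρ)) (hr0 : ∀ᶠ i in l, 0 ≤ r i) (n : ℕ) :
    Tendsto (fun i => (P (e i)).real (noJump β (e i) (x (e i)) (σ (e i)) (r i) ∩
      countEq (x (e i)) (σ (e i)) (I (r i)) A n)) l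
      (𝓝 ((ρ * κ) ^ n / n.factorial * Real.exp (-(ρ * (κ + f 0))))) := by
  set T : ι → ℝ := fun i => hitTime (x (e i)) (1 - e i ^ β) with hTdef
  set m : ι → ℝ := fun i => meanTime h β (e i) (x (e i)) with hmdef
  set q : ι → ℝ := fun i => survival h (e i) (x (e i)) (T i) with hqdef
  -- With `δ = T ^ (1/4)`, both `δ` and the Chebyshev terms `T / δ ^ 2`, `T / (δ - T) ^ 2` tend to
  -- `0`.
  set δ : ι → ℝ := fun i => √(√(T i)) with hδdef
  have hepos : ∀ᶠ i in l, 0 < e i := he self_mem_nhdsWithin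
  have hhit : ∀ᶠ i in l, IsHit (x (e i)) (1 - e i ^ β) (T i) := he (eventually_hit hfh hβ hx)
  have hT : Tendsto T l (𝓝 0) := (tendsto_hitTime hfh hβ hx).comp he
  have hm : Tendsto m l (𝓝 0) := (tendsto_meanTime hfh hβ hx).comp he
  have hmpos : ∀ᶠ i in l, 0 < m i := by
    filter_upwards [hepos, hhit] with i h1 h2 using (hx _ h1).meanTime_pos hfh h2.pos
  have hδ : Tendsto δ l (𝓝 0) := by
    have := hT.sqrt.sqrt
    simpa using this
  have hδpos : ∀ᶠ i in l, 0 < δ i := by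
    filter_upwards [hhit] with i h1 using Real.sqrt_pos.2 (Real.sqrt_pos.2 h1.pos)
  have hTδ : ∀ᶠ i in l, T i = δ i ^ 4 := by
    filter_upwards [hhit] with i h1
    rw [show 4 = 2 * 2 from rfl, pow_mul, Real.sq_sqrt (Real.sqrt_nonneg _),
      Real.sq_sqrt h1.pos.le]
  have hpm : Tendsto (fun i => p (e i) / m i) l (𝓝 κ) := hp.comp he
  have hqm : Tendsto (fun i => q i / m i) l (𝓝 (f 0)) :=
    (tendsto_survival_hitTime_div hfh hβ hx).comp he
  have hp0 : Tendsto (fun i => p (e i)) l (𝓝 0) := by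
    have := hpm.mul hm
    rw [mul_zero] at this
    refine this.congr' ?_
    filter_upwards [hmpos] with i hi using div_mul_cancel₀ _ hi.ne'
  have hq0 : Tendsto q l (𝓝 0) := by
    have := hqm.mul hm
    rw [mul_zero] at this
    refine this.congr' ?_
    filter_upwards [hmpos] with i hi using div_mul_cancel₀ _ hi.ne'
  set M : ι → ℕ := fun i => ⌊(r i - δ i) / m i⌋₊ with hMdef
  have hM : Tendsto (fun i => M i * m i) l (𝓝 ρ) := by
    have hlow : Tendsto (fun i => r i - δ i - m i) l (𝓝 ρ) := by
      simpa using (hr.sub hδ).sub hm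
    refine tendsto_of_tendsto_of_tendsto_of_le_of_le' hlow hr ?_ ?_
    · filter_upwards [hmpos] with i hi
      have h1 := (Nat.lt_floor_add_one ((r i - δ i) / m i)).le
      rw [div_le_iff₀ hi] at h1
      change _ ≤ ((M i : ℝ) + 1) * m i at h1
      linarith
    · filter_upwards [hmpos, hr0, hδpos] with i hi hri hδi
      rcases le_or_gt 0 ((r i - δ i) / m i) with h1 | h1
      · have h2 := Nat.floor_le h1
        rw [le_div_iff₀ hi] at h2
        change (M i : ℝ) * m i ≤ _ at h2
        linarith
      · have : M i = 0 := Nat.floor_of_nonpos h1.le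
        rw [this]
        simpa using hri
  have hMp : Tendsto (fun i => M i * p (e i)) l (𝓝 (ρ * κ)) := by
    refine (hM.mul hpm).congr' ?_
    filter_upwards [hmpos] with i hi
    field_simp
  have hMv : Tendsto (fun i => M i * (p (e i) + q i)) l (𝓝 (ρ * (κ + f 0))) := by
    refine (hM.mul (hpm.add hqm)).congr' ?_
    filter_upwards [hmpos] with i hi
    field_simp
  have hv0 : Tendsto (fun i => p (e i) + q i) l (𝓝 0) := by simpa using hp0.add hq0
  have hbin := tendsto_binomial hMp hp0 hMv hv0 n
  have herr : Tendsto (fun i => r i * (δ i ^ 2 / (1 - δ i ^ 3) ^ 2) +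
      (r i + δ i + m i) * δ i ^ 2 + (2 * δ i * (p (e i) / m i + q i / m i) +
        2 * (p (e i) + q i))) l (𝓝 0) := by
    have h1 := hr.mul ((hδ.pow 2).div (((hδ.pow 3).const_sub 1).pow 2) (by norm_num))
    have h2 := ((hr.add hδ).add hm).mul (hδ.pow 2)
    have h3 := ((hδ.const_mul 2).mul (hpm.add hqm)).add (hv0.const_mul 2)
    simpa using (h1.add h2).add h3
  have hdiff : Tendsto (fun i => (P (e i)).real (noJump β (e i) (x (e i)) (σ (e i)) (r i) ∩
      countEq (x (e i)) (σ (e i)) (I (r i)) A n) -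
      ((M i).choose n * p (e i) ^ n * (1 - (p (e i) + q i)) ^ (M i - n))) l (𝓝 0) := by
    refine squeeze_zero_norm' ?_ herr
    filter_upwards [hepos, hhit, hmpos, hδpos, hTδ, he hH, hr0,
      hδ.eventually_lt_const (show (0 : ℝ) < 1 by norm_num)]
      with i hi hhi hmi hδi hTi hHi hri hδ1
    have hTδ' : T i < δ i := by
      rw [hTi]
      exact pow_lt_self_of_lt_one₀ hδi hδ1 (by norm_num)
    have hw := hσ _ hi
    have := abs_prob_sub_le hw.measurable hw.indep hw.pos (hx _ hi).continuousOn hhi hmi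
      (fun n => hw.integral_min n hhi.pos) hHi.1 hHi.2.1 hHi.2.2.1 hHi.2.2.2
      (fun n => hw.prob_gt n hhi.pos.le) hri hTδ' (hI (r i)) (hI' (r i)) n
    rw [Real.norm_eq_abs]
    refine this.trans (le_of_eq ?_)
    have hd3 : 1 - δ i ^ 3 ≠ 0 := by
      have : δ i ^ 3 < 1 := pow_lt_one₀ hδi.le hδ1 (by norm_num)
      linarith
    have e1 : T i / (δ i - T i) ^ 2 = δ i ^ 2 / (1 - δ i ^ 3) ^ 2 := by
      rw [hTi, show δ i - δ i ^ 4 = δ i * (1 - δ i ^ 3) by ring, mul_pow]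
      field_simp
    have e2 : T i / δ i ^ 2 = δ i ^ 2 := by
      rw [hTi]
      field_simp
    rw [mul_div_assoc, mul_div_assoc, e1, e2]
    change _ + _ + (2 * δ i / m i + 2) * (p (e i) + q i) = _
    field_simp
  have := hdiff.add hbin
  simpa using this

theorem eventually_marks_Icc {f h : ℝ → ℝ} (hfh : Coefficients f h) {β : ℝ}
    (hβ : β ∈ Ioo (0 : ℝ) (1 / 2)) {x : ℝ → ℝ → ℝ} (hx : ∀ ε : ℝ, 0 < ε → IsFlow f h ε (x ε))
    {Ω : ℝ → Type*} [∀ ε, MeasurableSpace (Ω ε)]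
    {P : ∀ ε, Measure (Ω ε)} [∀ ε, IsProbabilityMeasure (P ε)]
    {σ : ∀ ε, ℕ → Ω ε → ℝ}
    (hσ : ∀ ε : ℝ, 0 < ε → IsWaitingTimes (P ε) h ε (x ε) (σ ε))
    {a b : ℝ} (ha : 0 < a) (hab : a ≤ b) :
    ∀ᶠ ε in 𝓝[>] (0 : ℝ),
      MeasurableSet (Ioc (hitTime (x ε) (min a (1 - ε ^ β))) (hitTime (x ε) (min b (1 - ε ^ β)))) ∧
      Ioc (hitTime (x ε) (min a (1 - ε ^ β))) (hitTime (x ε) (min b (1 - ε ^ β))) ⊆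
        Iic (hitTime (x ε) (1 - ε ^ β)) ∧
      (∀ᵐ ω ∂P ε, ∀ n, σ ε n ω ≤ hitTime (x ε) (1 - ε ^ β) → (x ε (σ ε n ω) ∈ Icc a b ↔ σ ε n ω ∈
        Ioc (hitTime (x ε) (min a (1 - ε ^ β))) (hitTime (x ε) (min b (1 - ε ^ β))))) ∧
      ∀ n, (P ε).real (σ ε n ⁻¹'
        Ioc (hitTime (x ε) (min a (1 - ε ^ β))) (hitTime (x ε) (min b (1 - ε ^ β)))) =
        survival h ε (x ε) (hitTime (x ε) (min a (1 - ε ^ β))) -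
          survival h ε (x ε) (hitTime (x ε) (min b (1 - ε ^ β))) := by
  filter_upwards [self_mem_nhdsWithin, eventually_hit hfh hβ hx,
    (tendsto_one_sub_rpow hβ.1).eventually_const_lt one_pos] with ε (hε : 0 < ε) hhit hy
  have hle : ∀ c, min c (1 - ε ^ β) ≤ x ε (hitTime (x ε) (1 - ε ^ β)) := fun c =>
    hhit.map_eq.symm ▸ min_le_right _ _
  refine ⟨measurableSet_Ioc, fun s hs => hs.2.trans (hitTime_le hhit.pos.le (hle b)), ?_,
    fun n => (hσ ε hε).prob_Ioc n (hitTime_nonneg _ _)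
      (hitTime_mono (min_le_min_right _ hab) hhit.pos.le (hle b))⟩
  filter_upwards [ae_all_iff.2 (hσ ε hε).pos, ae_all_iff.2 fun n =>
    (hσ ε hε).ae_ne hfh (hx ε hε) n (hitTime_nonneg (x ε) (min a (1 - ε ^ β)))] with ω h1 h2 n hn
  exact mem_Icc_iff_mem_Ioc (hx ε hε) hy.le rfl hhit ha.le (ha.le.trans hab) (h1 n) hn (h2 n)

theorem tendsto_prob_noJump_count_Icc {f h : ℝ → ℝ} (hfh : Coefficients f h) {β : ℝ}
    (hβ : β ∈ Ioo (0 : ℝ) (1 / 2)) {x : ℝ → ℝ → ℝ} (hx : ∀ ε : ℝ, 0 < ε → IsFlow f h ε (x ε))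
    {Ω : ℝ → Type*} [∀ ε, MeasurableSpace (Ω ε)]
    {P : ∀ ε, Measure (Ω ε)} [∀ ε, IsProbabilityMeasure (P ε)]
    {σ : ∀ ε, ℕ → Ω ε → ℝ}
    (hσ : ∀ ε : ℝ, 0 < ε → IsWaitingTimes (P ε) h ε (x ε) (σ ε))
    {a b : ℝ} (ha : 0 < a) (hab : a ≤ b) (hb : b ≤ 1)
    {I : ℝ → Set ℝ} (hI : ∀ r, Ioo 0 r ⊆ I r) (hI' : ∀ r, I r ⊆ Ioc 0 r)
    {ι : Type*} {l : Filter ι} {e r : ι → ℝ} {ρ : ℝ} (he : Tendsto e l (𝓝[>] 0))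
    (hr : Tendsto r l (𝓝 ρ)) (hr0 : ∀ᶠ i in l, 0 ≤ r i) (n : ℕ) :
    Tendsto (fun i => (P (e i)).real (noJump β (e i) (x (e i)) (σ (e i)) (r i) ∩
      countEq (x (e i)) (σ (e i)) (I (r i)) (Icc a b) n)) l
      (𝓝 ((ρ * (f 0 * (1 / a - 1 / b))) ^ n / n.factorial *
        Real.exp (-(ρ * (f 0 * (1 / a - 1 / b) + f 0))))) := by
  refine tendsto_prob_noJump_count hfh hβ hx hσ (eventually_marks_Icc hfh hβ hx hσ ha hab)
    ?_ hI hI' he hr hr0 n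
  have := (tendsto_survival_div hfh hβ hx ha (hab.trans hb)).sub
    (tendsto_survival_div hfh hβ hx (ha.trans_le hab) hb)
  rw [show f 0 / a - f 0 / b = f 0 * (1 / a - 1 / b) by ring] at this
  exact this.congr fun ε => (sub_div _ _ _).symm

/-- With an empty set of marks and `n = 0`, the count condition always holds and only the jump
remains. -/
theorem tendsto_prob_noJump {f h : ℝ → ℝ} (hfh : Coefficients f h) {β : ℝ}
    (hβ : β ∈ Ioo (0 : ℝ) (1 / 2)) {x : ℝ → ℝ → ℝ} (hx : ∀ ε : ℝ, 0 < ε → IsFlow f h ε (x ε))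
    {Ω : ℝ → Type*} [∀ ε, MeasurableSpace (Ω ε)]
    {P : ∀ ε, Measure (Ω ε)} [∀ ε, IsProbabilityMeasure (P ε)]
    {σ : ∀ ε, ℕ → Ω ε → ℝ}
    (hσ : ∀ ε : ℝ, 0 < ε → IsWaitingTimes (P ε) h ε (x ε) (σ ε)) {t : ℝ} (ht : 0 < t) :
    Tendsto (fun ε => (P ε).real (noJump β ε (x ε) (σ ε) t)) (𝓝[>] 0)
      (𝓝 (Real.exp (-(t * f 0)))) := by
  have := tendsto_prob_noJump_count (A := ∅) (H := fun _ => ∅) (p := fun _ => 0) (κ := 0)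
    (I := fun r => Ioo 0 r) hfh hβ hx hσ (Eventually.of_forall fun ε => by simp) (by simp)
    (fun r => le_rfl) (fun r => Ioo_subset_Ioc_self) tendsto_id (tendsto_const_nhds (x := t))
    (Eventually.of_forall fun _ => ht.le) 0
  simpa [countEq, preSpikeCount] using this

/-! ### Weak convergence on `ℕ` and the main theorem. -/

/-- On `ℕ`, convergence of the masses of probability measures implies weak convergence. -/
theorem tendsto_probabilityMeasure_nat {ι : Type*} {l : Filter ι} [l.IsCountablyGenerated]
    {μ : ι → ProbabilityMeasure ℕ} {ν : ProbabilityMeasure ℕ}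
    (h : ∀ n, Tendsto (fun i => (μ i : Measure ℕ) {n}) l (𝓝 ((ν : Measure ℕ) {n}))) :
    Tendsto μ l (𝓝 ν) := by
  refine IsPiSystem.tendsto_probabilityMeasure_of_tendsto_of_mem
    (S := insert ∅ (range fun n : ℕ => ({n} : Set ℕ))) ?_ (fun _ _ => MeasurableSet.of_discrete)
    (fun u _ n hn => ⟨{n}, Or.inr ⟨n, rfl⟩, by simp, by simpa using hn⟩) ?_
  · rintro _ (rfl | ⟨i, rfl⟩) _ (rfl | ⟨j, rfl⟩) hne
    · simp at hne
    · simp at hne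
    · simp at hne
    · obtain ⟨k, hk1, hk2⟩ := hne
      rw [mem_singleton_iff] at hk1 hk2
      subst hk1 hk2
      exact Or.inr ⟨k, by simp⟩
  · rintro _ (rfl | ⟨n, rfl⟩)
    · simp [tendsto_const_nhds]
    · exact (ENNReal.tendsto_toNNReal (measure_ne_top _ _)).comp (h n)

end Resetting

theorem corollary2p4 (f h : ℝ → ℝ) (hfh : Resetting.Coefficients f h)
    (β : ℝ) (hβ : β ∈ Set.Ioo (0 : ℝ) (1 / 2))
    (x : ℝ → ℝ → ℝ) (hx : ∀ ε : ℝ, 0 < ε → Resetting.IsFlow f h ε (x ε))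
    {Ω : ℝ → Type*} [∀ ε, MeasurableSpace (Ω ε)]
    (P : ∀ ε, Measure (Ω ε)) [∀ ε, IsProbabilityMeasure (P ε)]
    (σ : ∀ ε, ℕ → Ω ε → ℝ)
    (hσ : ∀ ε : ℝ, 0 < ε → Resetting.IsWaitingTimes (P ε) h ε (x ε) (σ ε))
    (a b : ℝ) (ha : 0 < a) (hab : a ≤ b) (hb : b ≤ 1) :
    Resetting.lamStar f (Icc a b) = ENNReal.ofReal (f 0 * (1 / a - 1 / b)) ∧
    (∀ t : ℝ, 0 < t →
      (∀ᶠ ε in 𝓝[>] (0 : ℝ), 0 < P ε (Resetting.noJump β ε (x ε) (σ ε) t)) ∧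
      ∃ L : ℝ → ProbabilityMeasure ℕ,
        (∀ᶠ ε in 𝓝[>] (0 : ℝ),
          (L ε : Measure ℕ) = Resetting.condLaw (P ε) β ε (x ε) (σ ε) t a b) ∧
        Tendsto L (𝓝[>] (0 : ℝ))
          (𝓝 (⟨poissonMeasure (Real.toNNReal (f 0 * t * (1 / a - 1 / b))), inferInstance⟩ :
            ProbabilityMeasure ℕ))) ∧
    (∀ n : ℕ, ∀ T : ℝ, 0 < T →
      TendstoUniformlyOn
        (fun ε r => Resetting.jointProb (P ε) β ε (x ε) (σ ε) a b n r)
        (fun r => Real.exp (-(r * f 0)) *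
          (Real.exp (-(r * (Resetting.lamStar f).real (Icc a b))) *
            (r * (Resetting.lamStar f).real (Icc a b)) ^ n / (n.factorial : ℝ)))
        (𝓝[>] (0 : ℝ)) (Icc 0 T)) := by
  open Resetting in
  have hf0 := hfh.f_zero_pos
  have hlam := lamStar_Icc hf0 ha hab hb
  have hdiff : 0 ≤ 1 / a - 1 / b := sub_nonneg.2 (one_div_le_one_div_of_le ha hab)
  have hlam' : (lamStar f).real (Icc a b) = f 0 * (1 / a - 1 / b) := by
    rw [measureReal_def, hlam, ENNReal.toReal_ofReal (by positivity)]
  refine ⟨hlam, fun t ht => ?_, fun n T hT => ?_⟩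
  · have hN := tendsto_prob_noJump hfh hβ hx hσ ht
    have hNpos := hN.eventually_const_lt (Real.exp_pos _)
    refine ⟨hNpos.mono fun ε hε => pos_iff_ne_zero.2 fun h0 => ?_, ?_⟩
    · rw [measureReal_def, h0] at hε
      simp at hε
    set ν : ProbabilityMeasure ℕ :=
      ⟨poissonMeasure (Real.toNNReal (f 0 * t * (1 / a - 1 / b))), inferInstance⟩
    have hprob : ∀ᶠ ε in 𝓝[>] (0 : ℝ),
        IsProbabilityMeasure (condLaw (P ε) β ε (x ε) (σ ε) t a b) := by
      filter_upwards [hNpos, self_mem_nhdsWithin, eventually_hit hfh hβ hx] with ε h1 h2 h3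
      exact isProbabilityMeasure_condLaw (hx ε h2) (hσ ε h2) h3
        ((hx ε h2).meanTime_pos hfh h3.pos) h1
    -- The conditional law is known to be a probability measure only for small `ε`; otherwise the
    -- limit `ν` serves as a default value.
    have hex : ∀ ε, ∃ Q : ProbabilityMeasure ℕ,
        IsProbabilityMeasure (condLaw (P ε) β ε (x ε) (σ ε) t a b) →
          (Q : Measure ℕ) = condLaw (P ε) β ε (x ε) (σ ε) t a b := fun ε => by
      by_cases hε : IsProbabilityMeasure (condLaw (P ε) β ε (x ε) (σ ε) t a b)
      · exact ⟨⟨_, hε⟩, fun _ => rfl⟩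
      · exact ⟨ν, fun h => absurd h hε⟩
    choose L hLeq using hex
    have hL := hprob.mono fun ε hε => hLeq ε hε
    refine ⟨L, hL, tendsto_probabilityMeasure_nat fun n => ?_⟩
    have hcond : Tendsto (fun ε => condProb (P ε) β ε (x ε) (σ ε) t a b n) (𝓝[>] 0)
        (𝓝 (Real.exp (-(f 0 * t * (1 / a - 1 / b))) * (f 0 * t * (1 / a - 1 / b)) ^ n /
          n.factorial)) := by
      have h1 := tendsto_prob_noJump_count_Icc (I := fun r => Ioo 0 r) hfh hβ hx hσ ha hab hb
        (fun r => le_rfl) (fun r => Ioo_subset_Ioc_self) tendsto_id (tendsto_const_nhds (x := t))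
        (Eventually.of_forall fun _ => ht.le) n
      convert! h1.div hN (Real.exp_ne_zero _) using 2
      · simp only [condProb, id, Pi.div_apply, inter_comm]
      · rw [mul_div_assoc _ (Real.exp _) (Real.exp _), ← Real.exp_sub, show t * (f 0 * (1 / a - 1 / b)) =
          f 0 * t * (1 / a - 1 / b) by ring, show -(t * (f 0 * (1 / a - 1 / b) + f 0)) -
          -(t * f 0) = -(f 0 * t * (1 / a - 1 / b)) by ring]
        ring
    have hν : (ν : Measure ℕ) {n} = ENNReal.ofReal (Real.exp (-(f 0 * t * (1 / a - 1 / b))) *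
        (f 0 * t * (1 / a - 1 / b)) ^ n / n.factorial) := by
      change poissonMeasure _ {n} = _
      rw [poissonMeasure_singleton, Real.coe_toNNReal _ (by positivity)]
    rw [hν]
    refine ((ENNReal.continuous_ofReal.tendsto _).comp hcond).congr' ?_
    filter_upwards [hL] with ε hε
    rw [hε, condLaw, Measure.sum_smul_dirac_singleton]
    rfl
  -- On a compact interval, with continuous limit, it suffices to have convergence as `(ε, r) → (0⁺,
  -- ρ)` jointly, for each `ρ`.
  · rw [hlam', ← tendstoLocallyUniformlyOn_iff_tendstoUniformlyOn_of_compact isCompact_Icc,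
      tendstoLocallyUniformlyOn_iff_forall_tendsto]
    intro ρ hρ
    have hsnd : Tendsto (Prod.snd : ℝ × ℝ → ℝ) (𝓝[>] 0 ×ˢ 𝓝[Icc 0 T] ρ) (𝓝 ρ) :=
      tendsto_snd.mono_right nhdsWithin_le_nhds
    have h1 := tendsto_prob_noJump_count_Icc (I := fun r => Ioc 0 r) hfh hβ hx hσ ha hab hb
      (fun r => Ioo_subset_Ioc_self) (fun r => le_rfl)
      (tendsto_fst (f := 𝓝[>] (0 : ℝ)) (g := 𝓝[Icc 0 T] ρ)) hsnd
      (tendsto_snd.eventually (eventually_mem_nhdsWithin.mono fun r hr => hr.1)) n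
    have hcont : Continuous fun r : ℝ => Real.exp (-(r * f 0)) *
        (Real.exp (-(r * (f 0 * (1 / a - 1 / b)))) * (r * (f 0 * (1 / a - 1 / b))) ^ n /
          (n.factorial : ℝ)) := by fun_prop
    have h2 := (hcont.tendsto ρ).comp hsnd
    have e : Real.exp (-(ρ * f 0)) * (Real.exp (-(ρ * (f 0 * (1 / a - 1 / b)))) *
        (ρ * (f 0 * (1 / a - 1 / b))) ^ n / (n.factorial : ℝ)) =
        (ρ * (f 0 * (1 / a - 1 / b))) ^ n / n.factorial *
        Real.exp (-(ρ * (f 0 * (1 / a - 1 / b) + f 0))) := by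
      rw [mul_add, neg_add, Real.exp_add]
      ring
    rw [e] at h2
    -- Both functions tend to the same number, so the pair eventually enters every entourage.
    exact (h2.prodMk_nhds h1).mono_right (nhds_le_uniformity _)
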